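/- Let $l_1,l_2\in\mathbb N_0$ be degrees, let $k_i,n_i\in\{-l_i,\dots,l_i\}$ ($i=1,2$) be integer orders, let $m\in\mathbb N_0$, and let $\theta_p\in[0,\pi]$, $\phi_p,\chi_p\in\mathbb R$ for $p=1,\dots,m$. For $l\in\mathbb N_0$ and integers $|k|,|n|\le l$ let $$\mathrm Y_l^k(\theta,\phi)=\sqrt{\tfrac{2l+1}{4\pi}\tfrac{(l-k)!}{(l+k)!}}\,P_l^k(\cos\theta)\,e^{\mathrm i k\phi},\qquad P_l^k(x)=\frac{(-1)^k}{2^l l!}(1-x^2)^{k/2}\frac{\mathrm d^{k+l}}{\mathrm dx^{k+l}}(x^2-1)^l$$ be the spherical harmonics (at $x=\pm1$ and $k<0$, $P_l^k$ is defined by its limit $0$), and let $$\mathrm D_l^{k,n}(\theta,\phi,\chi)=\sqrt{\tfrac{2l+1}{8\pi^2}}\,e^{-\mathrm ik\phi}\,\mathrm d_l^{k,n}(\cos\theta)\,e^{-\mathrm in\chi},\qquad \mathrm d_l^{k,n}(\cos\theta)=\omega\sqrt{\gamma}\,\sin^{\xi}\!\big(\tfrac\theta2\big)\cos^{\lambda}\!\big(\tfrac\theta2\big)P_\alpha^{(\xi,\lambda)}(\cos\theta)$$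 be the Wigner D-functions, where $\xi=|k-n|$, $\lambda=|k+n|$, $\alpha=l-\frac{\xi+\lambda}2$, $\gamma=\frac{\alpha!(\alpha+\xi+\lambda)!}{(\alpha+\xi)!(\alpha+\lambda)!}$, $\omega=1$ if $n\ge k$ and $\omega=(-1)^{n-k}$ if $n<k$, and $P_\alpha^{(\xi,\lambda)}$ is the Jacobi polynomial $$P_\alpha^{(\xi,\lambda)}(x)=\frac{(-1)^\alpha}{2^\alpha\alpha!}(1-x)^{-\xi}(1+x)^{-\lambda}\frac{\mathrm d^\alpha}{\mathrm dx^\alpha}\Big((1-x)^\xi(1+x)^\lambda(1-x^2)^\alpha\Big).$$ Let $\begin{pmatrix} l_1&l_2&l_3\\ m_1&m_2&m_3\end{pmatrix}\in\mathbb R$ denote the Wigner 3j symbol: it is $0$ unless $|m_i|\le l_i$ for $i=1,2,3$, $m_1+m_2+m_3=0$ and $|l_1-l_2|\le l_3\le l_1+l_2$, and in that case it equals $$(-1)^{l_1-l_2-m_3}\sqrt{\tfrac{(l_1+l_2-l_3)!(l_1-l_2+l_3)!(-l_1+l_2+l_3)!}{(l_1+l_2+l_3+1)!}}\sqrt{\textstyle\prod_{i=1}^3(l_i+m_i)!(l_i-m_i)!}\;\sum_t\frac{(-1)^t}{t!\,(l_3-l_2+t+m_1)!\,(l_3-l_1+t-m_2)!\,(l_1+l_2-l_3-t)!\,(l_1-t-m_1)!\,(l_2-t+m_2)!},$$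 the sum being over all integers $t$ for which all factorials have nonnegative arguments. Put $\hat k=k_2-k_1$ and $\hat n=n_2-n_1$. Then $$\sum_{p=1}^m\overline{\mathrm D_{l_1}^{k_1,n_1}(\theta_p,\phi_p,\chi_p)}\,\mathrm D_{l_2}^{k_2,n_2}(\theta_p,\phi_p,\chi_p)=(-1)^{k_2+n_2}\sum_{\hat l=|l_2-l_1|}^{l_1+l_2}\sqrt{\tfrac{(2l_1+1)(2l_2+1)(2\hat l+1)}{8\pi^2}}\begin{pmatrix} l_1&l_2&\hat l\\ -n_1&n_2&-\hat n\end{pmatrix}\begin{pmatrix} l_1&l_2&\hat l\\ -k_1&k_2&-\hat k\end{pmatrix}\Big(\sum_{p=1}^m\mathrm D_{\hat l}^{\hat k,\hat n}(\theta_p,\phi_p,\chi_p)\Big)$$ and $$\sum_{p=1}^m\overline{\mathrm Y_{l_1}^{k_1}(\theta_p,\phi_p)}\,\mathrm Y_{l_2}^{k_2}(\theta_p,\phi_p)=\sum_{p=1}^m(-1)^{k_1}\mathrm Y_{l_1}^{-k_1}(\theta_p,\phi_p)\,\mathrm Y_{l_2}^{k_2}(\theta_p,\phi_p)$$ $$=(-1)^{k_2}\sum_{\hat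 l=|l_1-l_2|}^{l_1+l_2}\sqrt{\tfrac{(2l_1+1)(2l_2+1)(2\hat l+1)}{4\pi}}\begin{pmatrix} l_1&l_2&\hat l\\ 0&0&0\end{pmatrix}\begin{pmatrix} l_1&l_2&\hat l\\ -k_1&k_2&-\hat k\end{pmatrix}\Big(\sum_{p=1}^m\mathrm Y_{\hat l}^{\hat k}(\theta_p,\phi_p)\Big).$$ Terms with $\hat l<|\hat k|$ or, in the first identity, $\hat l<|\hat n|$, in which $\mathrm D_{\hat l}^{\hat k,\hat n}$ or $\mathrm Y_{\hat l}^{\hat k}$ is not defined, have a vanishing 3j symbol and are read as $0$. -/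

import Mathlib

open Polynomial

noncomputable section

/-- Associated Legendre function `P_l^k`, for `-l ≤ k ≤ l`, on `[-1, 1]`:
`(-1)^k / (2^l l!) * (1 - x^2)^(k/2) * (d/dx)^(k+l) (x^2 - 1)^l`.
For `k < 0` and `x = ±1` the derivative vanishes to order `-k` and the formula below gives `0`,
which is the limit at the end point. -/
def assocLegendre (l : ℕ) (k : ℤ) (x : ℝ) : ℝ :=
  (-1 : ℝ) ^ k / (2 ^ l * (l.factorial : ℝ)) * (1 - x ^ 2) ^ ((k : ℝ) / 2) *
    (derivative^[(k + l).toNat] ((X ^ 2 - 1 : ℝ[X]) ^ l)).eval x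

/-- Spherical harmonic `Y_l^k(θ, φ)` of degree `l` and order `k`, `-l ≤ k ≤ l`. -/
def sphericalHarmonic (l : ℕ) (k : ℤ) (θ φ : ℝ) : ℂ :=
  ((Real.sqrt ((2 * l + 1) / (4 * Real.pi) *
      ((((l : ℤ) - k).toNat.factorial : ℝ) / (((l : ℤ) + k).toNat.factorial : ℝ))) *
    assocLegendre l k (Real.cos θ) : ℝ) : ℂ) * Complex.exp (Complex.I * k * φ)

/-- Jacobi polynomial `P_α^{(ξ,lam)}` by Rodrigues' formula
`(-1)^α / (2^α α!) * (1-x)^(-ξ) * (1+x)^(-lam) * (d/dx)^α ((1-x)^ξ (1+x)^lam (1-x^2)^α)`.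
The quotient is an exact division of polynomials, see `jacobiPoly_rodrigues`. -/
def jacobiPoly (α ξ lam : ℕ) : ℝ[X] :=
  C ((-1 : ℝ) ^ α / (2 ^ α * (α.factorial : ℝ))) *
    (derivative^[α] ((1 - X) ^ ξ * (1 + X) ^ lam * (1 - X ^ 2) ^ α) /
      ((1 - X) ^ ξ * (1 + X) ^ lam))

/-- The division in the definition of the Jacobi polynomials is exact. -/
theorem jacobiPoly_rodrigues (α ξ lam : ℕ) :
    (1 - X) ^ ξ * (1 + X) ^ lam * jacobiPoly α ξ lam =
      C ((-1 : ℝ) ^ α / (2 ^ α * (α.factorial : ℝ))) *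
        derivative^[α] ((1 - X) ^ ξ * (1 + X) ^ lam * (1 - X ^ 2) ^ α) := by
  have hd : ((1 - X) ^ ξ * (1 + X) ^ lam : ℝ[X]) ∣
      derivative^[α] ((1 - X) ^ ξ * (1 + X) ^ lam * (1 - X ^ 2) ^ α) := by
    have hfac : ((1 - X) ^ ξ * (1 + X) ^ lam * (1 - X ^ 2) ^ α : ℝ[X]) =
        (1 - X) ^ (ξ + α) * (1 + X) ^ (lam + α) := by
      have h : (1 - X ^ 2 : ℝ[X]) = (1 - X) * (1 + X) := by ring
      rw [h, mul_pow]
      ring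
    rw [hfac]
    have hco : IsCoprime (1 - X : ℝ[X]) (1 + X) := by
      refine ⟨C (1 / 2), C (1 / 2), ?_⟩
      rw [← mul_add]
      have h : (1 - X + (1 + X) : ℝ[X]) = C 2 := by
        rw [show (C 2 : ℝ[X]) = 2 from rfl]
        ring
      rw [h, ← C_mul]
      norm_num
    refine IsCoprime.mul_dvd hco.pow ?_ ?_
    · have h := pow_sub_dvd_iterate_derivative_of_pow_dvd α
        (dvd_mul_right ((1 - X : ℝ[X]) ^ (ξ + α)) ((1 + X) ^ (lam + α)))
      simpa using h
    · have h := pow_sub_dvd_iterate_derivative_of_pow_dvd α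
        (dvd_mul_left ((1 + X : ℝ[X]) ^ (lam + α)) ((1 - X) ^ (ξ + α)))
      simpa using h
  unfold jacobiPoly
  rw [mul_left_comm, EuclideanDomain.mul_div_cancel' _ hd]
  intro h0
  have h1 := congrArg (Polynomial.eval 0) h0
  simp at h1

/-- Wigner d-function `d_l^{k,n}(cos θ)`, for `-l ≤ k, n ≤ l` and `θ ∈ [0, π]`.
Here `ξ = |k - n|`, `lam = |k + n|`, `α = l - (ξ + lam) / 2 = l - max |k| |n|`. -/
def wignerSmallD (l : ℕ) (k n : ℤ) (θ : ℝ) : ℝ :=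
  let ξ : ℕ := (k - n).natAbs
  let lam : ℕ := (k + n).natAbs
  let α : ℕ := l - (ξ + lam) / 2
  let γ : ℝ := ((α.factorial : ℝ) * ((α + ξ + lam).factorial : ℝ)) /
    (((α + ξ).factorial : ℝ) * ((α + lam).factorial : ℝ))
  let ω : ℝ := if k ≤ n then 1 else (-1) ^ (n - k)
  ω * Real.sqrt γ * Real.sin (θ / 2) ^ ξ * Real.cos (θ / 2) ^ lam *
    (jacobiPoly α ξ lam).eval (Real.cos θ)

/-- Wigner D-function `D_l^{k,n}(θ, φ, χ)` of degree `l` and orders `-l ≤ k, n ≤ l`,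
normalized to unit norm on the rotation group with `sin θ dθ dφ dχ`. -/
def wignerD (l : ℕ) (k n : ℤ) (θ φ χ : ℝ) : ℂ :=
  (Real.sqrt ((2 * l + 1) / (8 * Real.pi ^ 2)) : ℂ) * Complex.exp (-(Complex.I * k * φ)) *
    (wignerSmallD l k n θ : ℂ) * Complex.exp (-(Complex.I * n * χ))

/-- Wigner 3j symbol with first row `l₁, l₂, l₃` and second row `k₁, k₂, k₃` (all integers), by
Racah's formula; the sum is over all `t` for which every factorial has a nonnegative argument.
The symbol is `0` unless `|kᵢ| ≤ lᵢ`, `k₁ + k₂ + k₃ = 0` and `|l₁ - l₂| ≤ l₃ ≤ l₁ + l₂`. -/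
def wigner3j (l₁ l₂ l₃ : ℕ) (k₁ k₂ k₃ : ℤ) : ℝ :=
  if |k₁| ≤ l₁ ∧ |k₂| ≤ l₂ ∧ |k₃| ≤ l₃ ∧ k₁ + k₂ + k₃ = 0 ∧
      |(l₁ : ℤ) - l₂| ≤ l₃ ∧ l₃ ≤ l₁ + l₂ then
    (-1 : ℝ) ^ ((l₁ : ℤ) - l₂ - k₃) *
    Real.sqrt ((((l₁ + l₂ - l₃).factorial : ℝ) * ((l₁ + l₃ - l₂).factorial : ℝ) *
      ((l₂ + l₃ - l₁).factorial : ℝ)) / ((l₁ + l₂ + l₃ + 1).factorial : ℝ)) *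
    Real.sqrt ((((l₁ : ℤ) + k₁).toNat.factorial : ℝ) * (((l₁ : ℤ) - k₁).toNat.factorial : ℝ) *
      (((l₂ : ℤ) + k₂).toNat.factorial : ℝ) * (((l₂ : ℤ) - k₂).toNat.factorial : ℝ) *
      (((l₃ : ℤ) + k₃).toNat.factorial : ℝ) * (((l₃ : ℤ) - k₃).toNat.factorial : ℝ)) *
    ∑ t ∈ (Finset.range (l₁ + l₂ - l₃ + 1)).filter (fun t : ℕ =>
        0 ≤ (l₃ : ℤ) - l₂ + t + k₁ ∧ 0 ≤ (l₃ : ℤ) - l₁ + t - k₂ ∧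
        0 ≤ (l₁ : ℤ) - t - k₁ ∧ 0 ≤ (l₂ : ℤ) - t + k₂),
      (-1 : ℝ) ^ t /
        ((t.factorial : ℝ) * (((l₃ : ℤ) - l₂ + t + k₁).toNat.factorial : ℝ) *
          (((l₃ : ℤ) - l₁ + t - k₂).toNat.factorial : ℝ) *
          ((l₁ + l₂ - l₃ - t).factorial : ℝ) *
          (((l₁ : ℤ) - t - k₁).toNat.factorial : ℝ) *
          (((l₂ : ℤ) - t + k₂).toNat.factorial : ℝ))
  else 0

end

/-! For θ in [0, π] the numbers `wignerSmallD l k n θ` are the matrix entries of a rotation acting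
on binary forms of degree 2l, in a normalised monomial basis. A spherical harmonic is, up to
normalisation, sign and phase, the row k = 0 of that matrix. Conjugating replaces the orders by
their negatives up to a sign. Both expansions are therefore the Clebsch-Gordan series for a product
of two matrix entries, taken pointwise and summed over p.

The series is obtained from generating functions. Let A = x(cy - s) + (sy + c), whose a-th power
generates the matrix of degree a, and let B be the same expression in u, v. Since c² + s² = 1, the
product AB minus the crossed product (y and v exchanged) equals E = (x - u)(y - v).
`pow_mul_pow_eq_sum` expands A^a B^b in powers of E. By `sum_linCoeff_mul_linCoeff_div_choose` the
cofactor of E^p is an invariant pairing of forms of degree a + b - 2p, one of them rotated, so it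
contains the rotation matrix of that degree. Comparing coefficients in x, u, y, v gives
`rotCoeff_mul_rotCoeff`.

The coupling coefficients so produced are those of (x - u)^p (u + 1)^q (x + 1)^r. Written out, they
are Racah's sum (`racah_sum_eq_tripleCoeff`), and `cgWeight_mul_rotCoeff` matches the
normalisations. Finally, the Leibniz rule applied to the Rodrigues formulas identifies the special
functions with matrix entries (`wignerSmallD_eq_rotMatrix`, `assocLegendre_cos`). -/

noncomputable section

/-! ### Binomial identities and the scalar Clebsch-Gordan expansion. -/

/-- Telescoping alternating sum. -/
lemma alternating_sum_factorial_partial (N n P : ℕ) (hP : P < n) (hN : 2 * n ≤ N) :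
    ∑ p ∈ Finset.range (P + 1), (-1 : ℝ) ^ p * ((N : ℝ) + 1 - 2 * p) * ((N - p - n).factorial : ℝ) /
      (((n - p).factorial : ℝ) * (p.factorial : ℝ) * ((N - p + 1).factorial : ℝ)) =
    (-1 : ℝ) ^ P * ((N - P - n).factorial : ℝ) /
      (n * ((n - P - 1).factorial : ℝ) * (P.factorial : ℝ) * ((N - P).factorial : ℝ)) := by
  induction P with
  | zero =>
    obtain ⟨d, rfl⟩ : ∃ d, n = d + 1 := ⟨n - 1, by omega⟩
    have h1 : ((d + 1 : ℕ) : ℝ) ≠ 0 := by positivity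
    simp only [Nat.sub_zero, zero_add, Finset.sum_range_one, Nat.add_sub_cancel, Nat.factorial_succ]
    have := Nat.factorial_ne_zero N
    have := Nat.factorial_ne_zero d
    push_cast at h1 ⊢
    have h2 : (N : ℝ) + 1 ≠ 0 := by positivity
    simp
    field_simp
  | succ P ih =>
    rw [Finset.sum_range_succ, ih (by omega)]
    obtain ⟨d, rfl⟩ : ∃ d, n = P + 2 + d := ⟨n - (P + 2), by omega⟩
    obtain ⟨e, rfl⟩ : ∃ e, N = 2 * (P + 2 + d) + e := ⟨N - 2 * (P + 2 + d), by omega⟩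
    rw [show 2 * (P + 2 + d) + e - P - (P + 2 + d) = d + e + 2 by omega,
      show P + 2 + d - P - 1 = d + 1 by omega,
      show 2 * (P + 2 + d) + e - P = P + 2 * d + e + 4 by omega,
      show 2 * (P + 2 + d) + e - (P + 1) - (P + 2 + d) = d + e + 1 by omega,
      show P + 2 + d - (P + 1) = d + 1 by omega,
      show 2 * (P + 2 + d) + e - (P + 1) = P + 2 * d + e + 3 by omega,
      show d + 1 - 1 = d by omega]
    simp only [Nat.factorial_succ]
    have h1 : (d.factorial : ℝ) ≠ 0 := by positivity
    have h2 : (P.factorial : ℝ) ≠ 0 := by positivity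
    have h3 : ((P + 2 * d + e).factorial : ℝ) ≠ 0 := by positivity
    have h4 : ((d + e).factorial : ℝ) ≠ 0 := by positivity
    push_cast
    have h5 : (P : ℝ) + 2 + d ≠ 0 := by positivity
    have h6 : (P : ℝ) + 1 ≠ 0 := by positivity
    have h7 : (P : ℝ) + 2 * d + e + 1 ≠ 0 := by positivity
    have h8 : (P : ℝ) + 2 * d + e + 1 + 1 ≠ 0 := by positivity
    have h9 : (P : ℝ) + 2 * d + e + 2 + 1 ≠ 0 := by positivity
    have h10 : (P : ℝ) + 2 * d + e + 3 + 1 ≠ 0 := by positivity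
    field_simp
    ring

/-- The telescoped sum up to n - 1 is the negative of the last term. This is the cancellation that
kills every positive power of E in `pow_mul_pow_eq_sum`. -/
lemma alternating_sum_factorial (N n : ℕ) (hn : 0 < n) (hN : 2 * n ≤ N) :
    ∑ p ∈ Finset.range (n + 1), (-1 : ℝ) ^ p * ((N : ℝ) + 1 - 2 * p) * ((N - p - n).factorial : ℝ) /
      (((n - p).factorial : ℝ) * (p.factorial : ℝ) * ((N - p + 1).factorial : ℝ)) = 0 := by
  obtain ⟨d, rfl⟩ : ∃ d, n = d + 1 := ⟨n - 1, by omega⟩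
  obtain ⟨e, rfl⟩ : ∃ e, N = 2 * (d + 1) + e := ⟨N - 2 * (d + 1), by omega⟩
  rw [Finset.sum_range_succ, alternating_sum_factorial_partial _ _ d (by omega) hN]
  rw [show 2 * (d + 1) + e - d - (d + 1) = e + 1 by omega, show d + 1 - d - 1 = 0 by omega,
    show 2 * (d + 1) + e - d = d + e + 1 + 1 by omega,
    show 2 * (d + 1) + e - (d + 1) - (d + 1) = e by omega,
    show d + 1 - (d + 1) = 0 by omega, show 2 * (d + 1) + e - (d + 1) = d + e + 1 by omega]
  simp only [Nat.factorial_succ]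
  have h1 : (d.factorial : ℝ) ≠ 0 := by positivity
  have h3 : ((d + e).factorial : ℝ) ≠ 0 := by positivity
  have h4 : (e.factorial : ℝ) ≠ 0 := by positivity
  push_cast
  have h6 : (d : ℝ) + 1 ≠ 0 := by positivity
  have h7 : (d : ℝ) + e + 1 ≠ 0 := by positivity
  have h8 : (d : ℝ) + e + 1 + 1 ≠ 0 := by positivity
  field_simp
  ring

/-- Since C(q,j) C(j,i) = C(q,i) C(q-i,j-i), this reduces to Vandermonde's convolution. -/
lemma sum_choose_mul_choose_mul_choose (q r i : ℕ) (hi : i ≤ r) :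
    ∑ j ∈ Finset.range (r + 1), q.choose j * r.choose j * j.choose i =
      q.choose i * (q + r - i).choose q := by
  by_cases hq : i ≤ q
  swap
  · rw [Nat.choose_eq_zero_of_lt (by omega : q < i), zero_mul]
    refine Finset.sum_eq_zero fun j _ => ?_
    by_cases hj : j < i
    · rw [Nat.choose_eq_zero_of_lt hj, mul_zero]
    · rw [Nat.choose_eq_zero_of_lt (by omega : q < j)]
      simp
  obtain ⟨d, rfl⟩ : ∃ d, r = i + d := ⟨r - i, by omega⟩
  rw [show i + d + 1 = i + (d + 1) by omega, Finset.sum_range_add]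
  rw [Finset.sum_eq_zero fun j hj => by
    rw [Nat.choose_eq_zero_of_lt (Finset.mem_range.mp hj), mul_zero], zero_add]
  rw [show q + (i + d) - i = (q - i) + (i + d) by omega,
    ← Nat.choose_symm (by omega : q ≤ q - i + (i + d)),
    show q - i + (i + d) - q = d by omega, Nat.add_choose_eq,
    Finset.Nat.sum_antidiagonal_eq_sum_range_succ_mk, Finset.mul_sum]
  refine Finset.sum_congr rfl fun j hj => ?_
  rw [Finset.mem_range] at hj
  rw [mul_right_comm, Nat.choose_mul (by omega), Nat.add_sub_cancel_left,
    ← Nat.choose_symm (by omega : i + j ≤ i + d), show i + d - (i + j) = d - j by omega]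
  ring

lemma sum_choose_mul_pow_sub (q r : ℕ) (A B E : ℝ) :
    ∑ j ∈ Finset.range (r + 1), (q.choose j : ℝ) * r.choose j * A ^ (r - j) * B ^ (q - j) *
        (A * B - E) ^ j =
      ∑ i ∈ Finset.range (r + 1), (q.choose i : ℝ) * (q + r - i).choose q *
        A ^ (r - i) * B ^ (q - i) * (-E) ^ i := by
  have h : ∀ j ∈ Finset.range (r + 1), (q.choose j : ℝ) * r.choose j * A ^ (r - j) * B ^ (q - j) *
        (A * B - E) ^ j = ∑ i ∈ Finset.range (r + 1),
          (q.choose j : ℝ) * r.choose j * j.choose i * (A ^ (r - i) * B ^ (q - i) * (-E) ^ i) := by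
    intro j hj
    rw [Finset.mem_range] at hj
    by_cases hq : j ≤ q
    swap
    · rw [Nat.choose_eq_zero_of_lt (by omega : q < j)]
      simp
    rw [show A * B - E = -E + A * B by ring, add_pow, Finset.mul_sum]
    rw [← Finset.sum_subset (Finset.range_mono (by omega : j + 1 ≤ r + 1))]
    · refine Finset.sum_congr rfl fun i hi => ?_
      rw [Finset.mem_range] at hi
      rw [show r - i = (r - j) + (j - i) by omega, show q - i = (q - j) + (j - i) by omega]
      rw [pow_add, pow_add, mul_pow]
      ring
    · intro i _ hi
      rw [Nat.choose_eq_zero_of_lt (by simpa using hi : j < i)]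
      simp
  rw [Finset.sum_congr rfl h, Finset.sum_comm]
  refine Finset.sum_congr rfl fun i hi => ?_
  have h2 := sum_choose_mul_choose_mul_choose q r i (by simpa [Nat.lt_succ_iff] using hi)
  rw [← Finset.sum_mul]
  have h3 : (∑ j ∈ Finset.range (r + 1), (q.choose j : ℝ) * r.choose j * j.choose i) =
    (q.choose i : ℝ) * (q + r - i).choose q := by exact_mod_cast h2
  rw [h3]
  ring

/-- Clebsch-Gordan expansion of `A ^ a * B ^ b`. -/
lemma pow_mul_pow_eq_sum (a b : ℕ) (A B E : ℝ) :
    A ^ a * B ^ b = ∑ p ∈ Finset.range (min a b + 1),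
      ((a : ℝ) + b - 2 * p + 1) * a.factorial * b.factorial /
          ((a + b - p + 1).factorial * p.factorial) * E ^ p *
        ∑ j ∈ Finset.range (a - p + 1), ((b - p).choose j : ℝ) * (a - p).choose j *
          A ^ (a - p - j) * B ^ (b - p - j) * (A * B - E) ^ j := by
  -- Everything is rewritten in powers of E, with total exponent p + i. The range of i stops at min
  -- a b - p because C(b-p, i) vanishes beyond it.
  have h1 : ∀ p ∈ Finset.range (min a b + 1),
      ((a : ℝ) + b - 2 * p + 1) * a.factorial * b.factorial /
          ((a + b - p + 1).factorial * p.factorial) * E ^ p *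
        ∑ j ∈ Finset.range (a - p + 1), ((b - p).choose j : ℝ) * (a - p).choose j *
          A ^ (a - p - j) * B ^ (b - p - j) * (A * B - E) ^ j =
      ∑ i ∈ Finset.range (min a b + 1 - p), (fun p i : ℕ =>
        ((a : ℝ) + b - 2 * p + 1) * a.factorial * b.factorial /
          ((a + b - p + 1).factorial * p.factorial) * E ^ p *
        ((a + b - p - (p + i)).factorial / (i.factorial * (b - (p + i)).factorial *
          (a - (p + i)).factorial) *
          A ^ (a - (p + i)) * B ^ (b - (p + i)) * (-E) ^ i)) p i := by
    intro p hp
    rw [Finset.mem_range] at hp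
    rw [sum_choose_mul_pow_sub, Finset.mul_sum]
    rw [← Finset.sum_subset (Finset.range_mono (by omega : min a b + 1 - p ≤ a - p + 1))]
    · refine Finset.sum_congr rfl fun i hi => ?_
      rw [Finset.mem_range] at hi
      have hc : ((b - p).choose i : ℝ) * (b - p + (a - p) - i).choose (b - p) =
          (a + b - p - (p + i)).factorial / (i.factorial * (b - (p + i)).factorial *
          (a - (p + i)).factorial) := by
        rw [Nat.cast_choose ℝ (by omega : i ≤ b - p),
          Nat.cast_choose ℝ (by omega : b - p ≤ b - p + (a - p) - i)]
        rw [show b - p + (a - p) - i = a + b - p - (p + i) by omega,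
          show a + b - p - (p + i) - (b - p) = a - (p + i) by omega,
          show b - p - i = b - (p + i) by omega]
        have := Nat.factorial_ne_zero (b - p)
        field_simp
      simp only
      rw [hc, show b - p - i = b - (p + i) by omega, show a - p - i = a - (p + i) by omega]
    · intro i hi hi'
      rw [Finset.mem_range] at hi hi'
      rw [Nat.choose_eq_zero_of_lt (by omega : b - p < i)]
      simp
  rw [Finset.sum_congr rfl h1, ← Finset.sum_range_diag_flip, Finset.sum_range_succ']
  -- After regrouping by n = p + i, the coefficient of each positive power of E is a multiple of the
  -- alternating sum with N = a + b. Only the power E^0 survives.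
  have h2 : ∀ n ∈ Finset.range (min a b), ∑ k ∈ Finset.range (n + 1 + 1), (fun p i : ℕ =>
        ((a : ℝ) + b - 2 * p + 1) * a.factorial * b.factorial /
          ((a + b - p + 1).factorial * p.factorial) * E ^ p *
        ((a + b - p - (p + i)).factorial / (i.factorial * (b - (p + i)).factorial *
          (a - (p + i)).factorial) *
          A ^ (a - (p + i)) * B ^ (b - (p + i)) * (-E) ^ i)) k (n + 1 - k) = 0 := by
    intro n hn
    rw [Finset.mem_range] at hn
    have h3 := alternating_sum_factorial (a + b) (n + 1) (by omega) (by omega)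
    have h4 := congrArg (fun z => z * ((-1) ^ (n + 1) * a.factorial * b.factorial * E ^ (n + 1) *
      A ^ (a - (n + 1)) * B ^ (b - (n + 1)) /
        ((b - (n + 1)).factorial * (a - (n + 1)).factorial))) h3
    simp only [zero_mul] at h4
    rw [← h4, Finset.sum_mul]
    refine Finset.sum_congr rfl fun k hk => ?_
    rw [Finset.mem_range] at hk
    obtain ⟨d, hd⟩ : ∃ d, n + 1 = k + d := ⟨n + 1 - k, by omega⟩
    have hs : (-1 : ℝ) ^ k * (-1) ^ k = 1 := by rw [← mul_pow]; simp
    simp only [hd, Nat.add_sub_cancel_left]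
    rw [neg_pow E d, pow_add (-1 : ℝ), pow_add E]
    push_cast
    field_simp
    linear_combination (-(a + b - 2 * k + 1) * E ^ k * E ^ d * A ^ (a - (k + d)) *
      B ^ (b - (k + d)) : ℝ) * hs
  rw [Finset.sum_eq_zero h2]
  simp only [zero_add, Finset.sum_range_one, Nat.factorial_zero, Nat.sub_zero, pow_zero,
    Nat.factorial_succ, CharP.cast_eq_zero, mul_zero, sub_zero]
  have := Nat.factorial_ne_zero a
  have := Nat.factorial_ne_zero b
  have := Nat.factorial_ne_zero (a + b)
  have h0 : (a : ℝ) + b + 1 ≠ 0 := by positivity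
  push_cast
  field_simp

/-! ### Comparison of coefficients and powers of linear forms. -/

/-- Infinitely many points determine a polynomial. Testing positive x only keeps the denominators of
later homogenisations away from zero. -/
lemma coeff_eq_of_sum_mul_pow_eq {n : ℕ} {f g : ℕ → ℝ}
    (h : ∀ x : ℝ, 0 < x → ∑ i ∈ Finset.range n, f i * x ^ i = ∑ i ∈ Finset.range n, g i * x ^ i) :
    ∀ i < n, f i = g i := by
  intro i hi
  have key : (∑ i ∈ Finset.range n, C (f i) * X ^ i : ℝ[X]) =
      ∑ i ∈ Finset.range n, C (g i) * X ^ i := by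
    refine Polynomial.eq_of_infinite_eval_eq _ _ ((Set.Ioi_infinite (0 : ℝ)).mono fun x hx => ?_)
    simpa [Polynomial.eval_finsetSum] using h x hx
  have := congrArg (fun p => p.coeff i) key
  simpa [Polynomial.finsetSum_coeff, Polynomial.coeff_X_pow, hi] using this

lemma coeff_eq_of_sum_sum_mul_pow_eq {n m : ℕ} {f g : ℕ → ℕ → ℝ}
    (h : ∀ x u : ℝ, 0 < x → 0 < u →
      ∑ i ∈ Finset.range n, ∑ j ∈ Finset.range m, f i j * (x ^ i * u ^ j) =
      ∑ i ∈ Finset.range n, ∑ j ∈ Finset.range m, g i j * (x ^ i * u ^ j)) :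
    ∀ i < n, ∀ j < m, f i j = g i j := by
  intro i hi
  refine coeff_eq_of_sum_mul_pow_eq fun u hu => ?_
  refine coeff_eq_of_sum_mul_pow_eq (n := n) (f := fun i => ∑ j ∈ Finset.range m, f i j * u ^ j)
    (g := fun i => ∑ j ∈ Finset.range m, g i j * u ^ j) (fun x hx => ?_) i hi
  have := h x u hx hu
  have e : ∀ (f : ℕ → ℕ → ℝ) (i j : ℕ), f i j * u ^ j * x ^ i = f i j * (x ^ i * u ^ j) :=
    fun f i j => by ring
  simpa only [Finset.sum_mul, e] using this

/-- The coefficient of `X ^ i` in `(u₁ X + u₂) ^ q * (x₁ X + x₂) ^ r`. -/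
def linCoeff (u₁ u₂ x₁ x₂ : ℝ) (q r i : ℕ) : ℝ :=
  ((C u₁ * X + C u₂) ^ q * (C x₁ * X + C x₂) ^ r : ℝ[X]).coeff i

lemma linCoeff_comm (u₁ u₂ x₁ x₂ : ℝ) (q r i : ℕ) :
    linCoeff u₁ u₂ x₁ x₂ q r i = linCoeff x₁ x₂ u₁ u₂ r q i := by
  rw [linCoeff, linCoeff, mul_comm]

lemma coeff_linear_pow (u₁ u₂ : ℝ) (q j : ℕ) :
    ((C u₁ * X + C u₂) ^ q : ℝ[X]).coeff j = q.choose j * u₁ ^ j * u₂ ^ (q - j) := by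
  have h : ((C u₁ * X + C u₂) ^ q : ℝ[X]) =
      ∑ m ∈ Finset.range (q + 1), C (u₁ ^ m * u₂ ^ (q - m) * q.choose m) * X ^ m := by
    rw [add_pow]
    refine Finset.sum_congr rfl fun m _ => ?_
    simp only [map_mul, map_pow, map_natCast]
    ring
  rw [h]
  simp only [Polynomial.finsetSum_coeff, Polynomial.coeff_C_mul, Polynomial.coeff_X_pow, mul_ite,
    mul_one, mul_zero, Finset.sum_ite_eq, Finset.mem_range]
  split_ifs with hj
  · ring
  · rw [Nat.choose_eq_zero_of_lt (by omega)]
    simp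

lemma linCoeff_eq_sum (u₁ u₂ x₁ x₂ : ℝ) (q r i : ℕ) :
    linCoeff u₁ u₂ x₁ x₂ q r i = ∑ j ∈ Finset.range (i + 1),
      (q.choose j * u₁ ^ j * u₂ ^ (q - j)) *
        (r.choose (i - j) * x₁ ^ (i - j) * x₂ ^ (r - (i - j))) := by
  rw [linCoeff, Polynomial.coeff_mul, Finset.Nat.sum_antidiagonal_eq_sum_range_succ_mk]
  simp only [coeff_linear_pow]

lemma sum_linCoeff_mul_pow (u₁ u₂ x₁ x₂ : ℝ) (q r n : ℕ) (hn : n = q + r) (z : ℝ) :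
    ∑ i ∈ Finset.range (n + 1), linCoeff u₁ u₂ x₁ x₂ q r i * z ^ i =
      (u₁ * z + u₂) ^ q * (x₁ * z + x₂) ^ r := by
  have hd : ((C u₁ * X + C u₂) ^ q * (C x₁ * X + C x₂) ^ r : ℝ[X]).natDegree < n + 1 := by
    have h1 : ∀ (α β : ℝ) (t : ℕ), ((C α * X + C β) ^ t : ℝ[X]).natDegree ≤ t := fun α β t => by
      simpa using Polynomial.natDegree_pow_le_of_le t (Polynomial.natDegree_linear_le (a := α) (b := β))
    have := Polynomial.natDegree_mul_le_of_le (h1 u₁ u₂ q) (h1 x₁ x₂ r)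
    omega
  have := Polynomial.eval_eq_sum_range' hd z
  simpa [linCoeff] using this.symm

lemma sum_linCoeff_mul_pow_mul_pow (u₁ u₂ x₁ x₂ : ℝ) (q r n : ℕ) (hn : n = q + r) (z w : ℝ)
    (hw : w ≠ 0) :
    ∑ i ∈ Finset.range (n + 1), linCoeff u₁ u₂ x₁ x₂ q r i * (z ^ i * w ^ (n - i)) =
      (u₁ * z + u₂ * w) ^ q * (x₁ * z + x₂ * w) ^ r := by
  have h := congrArg (fun t => t * w ^ n) (sum_linCoeff_mul_pow u₁ u₂ x₁ x₂ q r n hn (z / w))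
  simp only [Finset.sum_mul] at h
  have h1 : ∀ α β : ℝ, α * z + β * w = (α * (z / w) + β) * w := fun α β => by field_simp
  rw [h1, h1, mul_pow, mul_pow]
  rw [hn, pow_add] at h
  rw [mul_mul_mul_comm, ← h, ← hn]
  refine Finset.sum_congr rfl fun i hi => ?_
  rw [Finset.mem_range] at hi
  rw [← pow_add, ← hn, div_pow]
  conv_rhs => rw [show n = i + (n - i) by omega, pow_add]
  field_simp

/-- Both sides are the coefficient of x^i u^j in (xyu + xv + u + 1)^n, grouped by powers of x on the
left and by powers of u on the right. -/
lemma choose_mul_linCoeff (y v : ℝ) (n i j : ℕ) (hi : i ≤ n) (hj : j ≤ n) :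
    n.choose i * linCoeff y v 1 1 i (n - i) j = n.choose j * linCoeff y 1 v 1 j (n - j) i := by
  refine coeff_eq_of_sum_sum_mul_pow_eq (n := n + 1) (m := n + 1)
    (f := fun i j => n.choose i * linCoeff y v 1 1 i (n - i) j)
    (g := fun i j => n.choose j * linCoeff y 1 v 1 j (n - j) i) (fun x u _ _ => ?_) i
    (by omega) j (by omega)
  have e1 : ∑ i ∈ Finset.range (n + 1), ∑ j ∈ Finset.range (n + 1),
      n.choose i * linCoeff y v 1 1 i (n - i) j * (x ^ i * u ^ j) =
      (x * (y * u + v) + (1 * u + 1)) ^ n := by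
    rw [add_pow]
    refine Finset.sum_congr rfl fun i hi => ?_
    rw [Finset.mem_range] at hi
    rw [mul_pow, mul_assoc (x ^ i), ← sum_linCoeff_mul_pow _ _ _ _ i (n - i) n (by omega),
      Finset.mul_sum, Finset.sum_mul]
    exact Finset.sum_congr rfl fun j _ => by ring
  have e2 : ∑ j ∈ Finset.range (n + 1), ∑ i ∈ Finset.range (n + 1),
      n.choose j * linCoeff y 1 v 1 j (n - j) i * (x ^ i * u ^ j) =
      (u * (y * x + 1) + (v * x + 1)) ^ n := by
    rw [add_pow]
    refine Finset.sum_congr rfl fun j hj => ?_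
    rw [Finset.mem_range] at hj
    rw [mul_pow, mul_assoc (u ^ j), ← sum_linCoeff_mul_pow _ _ _ _ j (n - j) n (by omega),
      Finset.mul_sum, Finset.sum_mul]
    exact Finset.sum_congr rfl fun i _ => by ring
  rw [e1, Finset.sum_comm, e2]
  ring

/-- Contraction of two products of powers of linear forms with the invariant scalar product. -/
lemma sum_linCoeff_mul_linCoeff_div_choose (u₁ u₂ x₁ x₂ y v : ℝ) (q r n : ℕ) (hn : n = q + r) :
    n.choose r * ∑ i ∈ Finset.range (n + 1), linCoeff u₁ u₂ x₁ x₂ q r i *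
        (linCoeff v 1 y 1 q r i / n.choose i) =
      ∑ j ∈ Finset.range (r + 1), (q.choose j : ℝ) * r.choose j * (x₁ * y + x₂) ^ (r - j) *
        (u₁ * v + u₂) ^ (q - j) * ((x₁ * v + x₂) * (u₁ * y + u₂)) ^ j := by
  -- Substitute z = yt + v, w = t + 1 in the form (u₁z + u₂w)^q (x₁z + x₂w)^r and read off t^k. The
  -- case k = r is the contraction: `choose_mul_linCoeff` turns the substituted monomials into the
  -- second form divided by binomials.
  have h1 : ∀ k < n + 1, ∑ i ∈ Finset.range (n + 1), linCoeff u₁ u₂ x₁ x₂ q r i *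
      linCoeff y v 1 1 i (n - i) k =
      linCoeff (u₁ * y + u₂) (u₁ * v + u₂) (x₁ * y + x₂) (x₁ * v + x₂) q r k := by
    refine coeff_eq_of_sum_mul_pow_eq fun t ht => ?_
    rw [sum_linCoeff_mul_pow _ _ _ _ q r n hn]
    simp only [Finset.sum_mul]
    rw [Finset.sum_comm]
    trans ∑ i ∈ Finset.range (n + 1), linCoeff u₁ u₂ x₁ x₂ q r i *
      ((y * t + v) ^ i * (1 * t + 1) ^ (n - i))
    · refine Finset.sum_congr rfl fun i hi => ?_
      rw [Finset.mem_range] at hi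
      rw [← sum_linCoeff_mul_pow _ _ _ _ i (n - i) n (by omega), Finset.mul_sum]
      exact Finset.sum_congr rfl fun j _ => by ring
    · rw [sum_linCoeff_mul_pow_mul_pow _ _ _ _ q r n hn _ _ (by positivity)]
      congr 2 <;> ring
  have h2 := h1 r (by omega)
  rw [linCoeff_eq_sum] at h2
  trans ∑ i ∈ Finset.range (n + 1), linCoeff u₁ u₂ x₁ x₂ q r i * linCoeff y v 1 1 i (n - i) r
  · rw [Finset.mul_sum]
    refine Finset.sum_congr rfl fun i hi => ?_
    rw [Finset.mem_range] at hi
    have h3 := choose_mul_linCoeff y v n i r (by omega) (by omega)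
    rw [show n - r = q by omega] at h3
    have h4 : (n.choose i : ℝ) ≠ 0 := by
      exact_mod_cast (Nat.choose_pos (by omega : i ≤ n)).ne'
    rw [linCoeff_comm v]
    field_simp
    linear_combination (- linCoeff u₁ u₂ x₁ x₂ q r i) * h3
  · rw [h2]
    refine Finset.sum_congr rfl fun j hj => ?_
    rw [Finset.mem_range] at hj
    rw [Nat.choose_symm (by omega : j ≤ r), show r - (r - j) = j by omega, mul_pow]
    ring

/-! ### Rotations acting on binary forms. -/

/-- Matrix coefficients of a rotation acting on binary forms of degree `n`. -/
def rotCoeff (c s : ℝ) (n i j : ℕ) : ℝ := linCoeff c (-s) s c i (n - i) j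

lemma sum_rotCoeff_mul_pow (c s : ℝ) (n i : ℕ) (hi : i ≤ n) (y : ℝ) :
    ∑ j ∈ Finset.range (n + 1), rotCoeff c s n i j * y ^ j =
      (c * y - s) ^ i * (s * y + c) ^ (n - i) := by
  simp only [rotCoeff]
  rw [sum_linCoeff_mul_pow _ _ _ _ i (n - i) n (by omega), sub_eq_add_neg]

lemma sum_sum_rotCoeff (c s : ℝ) (n : ℕ) (x y : ℝ) :
    ∑ i ∈ Finset.range (n + 1), ∑ j ∈ Finset.range (n + 1),
      n.choose i * rotCoeff c s n i j * (x ^ i * y ^ j) =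
      (x * (c * y - s) + (s * y + c)) ^ n := by
  rw [add_pow]
  refine Finset.sum_congr rfl fun i hi => ?_
  rw [Finset.mem_range] at hi
  rw [mul_pow, mul_assoc (x ^ i), ← sum_rotCoeff_mul_pow _ _ _ _ (by omega),
    Finset.mul_sum, Finset.sum_mul]
  exact Finset.sum_congr rfl fun j _ => by ring

/-- Rotating a product of linear forms rotates each factor: u(cw - s) + (sw + c) = (uc + s)w + (c -
us). -/
lemma sum_linCoeff_mul_rotCoeff (c s : ℝ) (hc : 0 ≤ c) (hs : 0 ≤ s) (h : c ^ 2 + s ^ 2 = 1)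
    (u x : ℝ) (q r n j : ℕ) (hn : n = q + r) (hj : j ≤ n) :
    ∑ i ∈ Finset.range (n + 1), linCoeff u 1 x 1 q r i * rotCoeff c s n i j =
      linCoeff (u * c + s) (c - u * s) (x * c + s) (c - x * s) q r j := by
  refine coeff_eq_of_sum_mul_pow_eq (n := n + 1)
    (f := fun j => ∑ i ∈ Finset.range (n + 1), linCoeff u 1 x 1 q r i * rotCoeff c s n i j)
    (g := fun j => linCoeff (u * c + s) (c - u * s) (x * c + s) (c - x * s) q r j)
    (fun w hw => ?_) j (by omega)
  rw [sum_linCoeff_mul_pow _ _ _ _ q r n hn]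
  -- The second homogeneous coordinate must not vanish; c, s ≥ 0 are not both zero and w > 0.
  have hpos : s * w + c ≠ 0 := by
    intro h0
    have h1 : c = 0 := by nlinarith [mul_nonneg hs hw.le]
    have h2 : s * w = 0 := by linarith
    rcases mul_eq_zero.mp h2 with h3 | h3
    · subst h1; subst h3; norm_num at h
    · exact hw.ne' h3
  simp only [Finset.sum_mul]
  rw [Finset.sum_comm]
  trans ∑ i ∈ Finset.range (n + 1), linCoeff u 1 x 1 q r i *
      ((c * w - s) ^ i * (s * w + c) ^ (n - i))
  · refine Finset.sum_congr rfl fun i hi => ?_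
    rw [Finset.mem_range] at hi
    rw [← sum_rotCoeff_mul_pow _ _ _ _ (by omega), Finset.mul_sum]
    exact Finset.sum_congr rfl fun j _ => by ring
  · rw [sum_linCoeff_mul_pow_mul_pow _ _ _ _ q r n hn _ _ hpos]
    congr 2 <;> ring

/-! ### Coupling coefficients and the unnormalised product formula. -/

/-- The coefficient of `x ^ i * u ^ j` in `(x - u) ^ p * (u + 1) ^ q * (x + 1) ^ r`. -/
def tripleCoeff (p q r i j : ℕ) : ℝ :=
  ∑ t ∈ Finset.range (p + 1), if t ≤ j ∧ p - t ≤ i then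
    (-1 : ℝ) ^ t * p.choose t * q.choose (j - t) * r.choose (i - (p - t)) else 0

lemma sum_choose_sub_mul_pow (t p q : ℕ) (ht : t ≤ p) (u : ℝ) :
    ∑ j ∈ Finset.range (p + q + 1), (if t ≤ j then (q.choose (j - t) : ℝ) else 0) * u ^ j =
      u ^ t * (u + 1) ^ q := by
  rw [show p + q + 1 = t + (p - t + q + 1) by omega, Finset.sum_range_add]
  rw [Finset.sum_eq_zero fun j hj => by
    rw [if_neg (by rw [Finset.mem_range] at hj; omega), zero_mul], zero_add]
  rw [add_pow, Finset.mul_sum,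
    ← Finset.sum_subset (Finset.range_mono (by omega : q + 1 ≤ p - t + q + 1))]
  · refine Finset.sum_congr rfl fun j hj => ?_
    rw [if_pos (by omega), Nat.add_sub_cancel_left, pow_add]
    ring
  · intro j _ hj
    rw [if_pos (by omega), Nat.add_sub_cancel_left, Nat.choose_eq_zero_of_lt (by simpa using hj)]
    simp

lemma sum_sum_tripleCoeff (p q r : ℕ) (x u : ℝ) :
    ∑ i ∈ Finset.range (p + r + 1), ∑ j ∈ Finset.range (p + q + 1),
      tripleCoeff p q r i j * (x ^ i * u ^ j) = (x - u) ^ p * (u + 1) ^ q * (x + 1) ^ r := by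
  rw [show x - u = -u + x by ring, add_pow, Finset.sum_mul, Finset.sum_mul]
  simp only [tripleCoeff, Finset.sum_mul]
  rw [Finset.sum_congr rfl fun i _ => Finset.sum_comm, Finset.sum_comm]
  refine Finset.sum_congr rfl fun t ht => ?_
  rw [Finset.mem_range] at ht
  have h1 := sum_choose_sub_mul_pow t p q (by omega) u
  have h2 := sum_choose_sub_mul_pow (p - t) p r (by omega) x
  trans (-1 : ℝ) ^ t * p.choose t * (x ^ (p - t) * (x + 1) ^ r) * (u ^ t * (u + 1) ^ q)
  · rw [← h1, ← h2, mul_assoc, Finset.sum_mul_sum, Finset.mul_sum]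
    refine Finset.sum_congr rfl fun i _ => ?_
    rw [Finset.mul_sum]
    refine Finset.sum_congr rfl fun j _ => ?_
    by_cases h3 : t ≤ j <;> by_cases h4 : p - t ≤ i <;> simp [h3, h4]
    ring
  · rw [neg_pow]
    ring

/-- Evaluate the generating function of `tripleCoeff` at (xz, uz) and take the coefficient of
z^(i+p). Homogeneity leaves only i₁ + i₂ = i + p, which is the selection rule for the orders. -/
lemma sub_pow_mul_linCoeff (p q r i : ℕ) (x u : ℝ) :
    (x - u) ^ p * linCoeff u 1 x 1 q r i =
      ∑ i₁ ∈ Finset.range (p + r + 1), ∑ i₂ ∈ Finset.range (p + q + 1),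
        (if i + p = i₁ + i₂ then tripleCoeff p q r i₁ i₂ else 0) * (x ^ i₁ * u ^ i₂) := by
  have h : (C ((x - u) ^ p) * (((C u * X + C 1) ^ q * (C x * X + C 1) ^ r) * X ^ p) : ℝ[X]) =
      ∑ i₁ ∈ Finset.range (p + r + 1), ∑ i₂ ∈ Finset.range (p + q + 1),
        C (tripleCoeff p q r i₁ i₂ * (x ^ i₁ * u ^ i₂)) * X ^ (i₁ + i₂) := by
    refine Polynomial.funext fun z => ?_
    have := sum_sum_tripleCoeff p q r (x * z) (u * z)
    rw [show x * z - u * z = (x - u) * z by ring, mul_pow] at this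
    simp only [Polynomial.eval_finsetSum, Polynomial.eval_mul, Polynomial.eval_pow,
      Polynomial.eval_add, Polynomial.eval_C, Polynomial.eval_X]
    trans (x - u) ^ p * z ^ p * (u * z + 1) ^ q * (x * z + 1) ^ r
    · ring
    · rw [← this]
      refine Finset.sum_congr rfl fun i _ => Finset.sum_congr rfl fun j _ => ?_
      rw [pow_add, mul_pow, mul_pow]
      ring
  have h2 := congrArg (fun P => P.coeff (i + p)) h
  simp only [Polynomial.coeff_C_mul, Polynomial.coeff_mul_X_pow, Polynomial.finsetSum_coeff,
    Polynomial.coeff_X_pow] at h2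
  rw [linCoeff, h2]
  refine Finset.sum_congr rfl fun i _ => Finset.sum_congr rfl fun j _ => ?_
  split_ifs <;> simp

lemma sum_mul_sum_sum_mul {ι : Type*} (S : Finset ι) (w : ι → ℝ) (T : ι → ℕ → ℕ → ℝ)
    (m : ℕ → ℕ → ℝ) (a b : ℕ) :
    ∑ k ∈ S, w k * ∑ i ∈ Finset.range a, ∑ j ∈ Finset.range b, T k i j * m i j =
      ∑ i ∈ Finset.range a, ∑ j ∈ Finset.range b, (∑ k ∈ S, w k * T k i j) * m i j := by
  simp only [Finset.mul_sum, Finset.sum_mul]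
  rw [Finset.sum_comm]
  refine Finset.sum_congr rfl fun i _ => ?_
  rw [Finset.sum_comm]
  exact Finset.sum_congr rfl fun j _ => Finset.sum_congr rfl fun k _ => by ring

/-- Coefficients in four variables are compared two at a time, first in (y, v) and then in (x, u).
-/
lemma coeff_eq_of_product_expansion {ι : Type*} {S : Finset ι} {W : ι → ℝ}
    {T U : ι → ℕ → ℕ → ℝ} {F G : ℕ → ℕ → ℝ} {a b : ℕ}
    (h : ∀ x u y v : ℝ, 0 < x → 0 < u → 0 < y → 0 < v →
      (∑ i ∈ Finset.range a, ∑ j ∈ Finset.range a, F i j * (x ^ i * y ^ j)) *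
        (∑ i ∈ Finset.range b, ∑ j ∈ Finset.range b, G i j * (u ^ i * v ^ j)) =
      ∑ k ∈ S, W k * (∑ i ∈ Finset.range a, ∑ j ∈ Finset.range b, T k i j * (x ^ i * u ^ j)) *
        (∑ i ∈ Finset.range a, ∑ j ∈ Finset.range b, U k i j * (y ^ i * v ^ j)))
    (i₁ i₂ j₁ j₂ : ℕ) (hi₁ : i₁ < a) (hi₂ : i₂ < b) (hj₁ : j₁ < a) (hj₂ : j₂ < b) :
    F i₁ j₁ * G i₂ j₂ = ∑ k ∈ S, W k * T k i₁ i₂ * U k j₁ j₂ := by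
  refine coeff_eq_of_sum_sum_mul_pow_eq (n := a) (m := b)
    (f := fun j₁ j₂ => F i₁ j₁ * G i₂ j₂)
    (g := fun j₁ j₂ => ∑ k ∈ S, W k * T k i₁ i₂ * U k j₁ j₂) (fun y v hy hv => ?_) j₁ hj₁ j₂ hj₂
  rw [← sum_mul_sum_sum_mul S (fun k => W k * T k i₁ i₂) U (fun j₁ j₂ => y ^ j₁ * v ^ j₂)]
  refine coeff_eq_of_sum_sum_mul_pow_eq (n := a) (m := b)
    (f := fun i₁ i₂ => ∑ j₁ ∈ Finset.range a, ∑ j₂ ∈ Finset.range b,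
      F i₁ j₁ * G i₂ j₂ * (y ^ j₁ * v ^ j₂))
    (g := fun i₁ i₂ => ∑ k ∈ S, W k * T k i₁ i₂ * ∑ j₁ ∈ Finset.range a, ∑ j₂ ∈ Finset.range b,
      U k j₁ j₂ * (y ^ j₁ * v ^ j₂)) (fun x u hx hu => ?_) i₁ hi₁ i₂ hi₂
  trans ∑ k ∈ S, (W k * ∑ j₁ ∈ Finset.range a, ∑ j₂ ∈ Finset.range b,
      U k j₁ j₂ * (y ^ j₁ * v ^ j₂)) * ∑ i₁ ∈ Finset.range a, ∑ i₂ ∈ Finset.range b,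
      T k i₁ i₂ * (x ^ i₁ * u ^ i₂)
  · refine Eq.trans ?_ ((h x u y v hx hu hy hv).trans (Finset.sum_congr rfl fun k _ => by ring))
    rw [Finset.sum_mul_sum]
    refine Finset.sum_congr rfl fun i₁ _ => Finset.sum_congr rfl fun i₂ _ => ?_
    rw [Finset.sum_mul_sum, Finset.sum_mul]
    refine Finset.sum_congr rfl fun j₁ _ => ?_
    rw [Finset.sum_mul]
    exact Finset.sum_congr rfl fun j₂ _ => by ring
  · rw [sum_mul_sum_sum_mul]
    refine Finset.sum_congr rfl fun i₁ _ => Finset.sum_congr rfl fun i₂ _ => ?_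
    congr 1
    exact Finset.sum_congr rfl fun k _ => by ring

/-- The weight of the summand of degree `a + b - 2 * p` in the Clebsch-Gordan expansion. -/
def cgWeight (a b p : ℕ) : ℝ :=
  ((a : ℝ) + b - 2 * p + 1) * a.factorial * b.factorial /
    ((a + b - p + 1).factorial * p.factorial) * (a + b - 2 * p).choose (a - p)

lemma bilinear_pow_mul_pow_eq_sum (c s : ℝ) (hc : 0 ≤ c) (hs : 0 ≤ s) (h : c ^ 2 + s ^ 2 = 1)
    (a b : ℕ) (x u y v : ℝ) :
    (x * (c * y - s) + (s * y + c)) ^ a * (u * (c * v - s) + (s * v + c)) ^ b =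
      ∑ p ∈ Finset.range (min a b + 1), cgWeight a b p *
        ∑ i ∈ Finset.range (a + b - 2 * p + 1), ∑ j ∈ Finset.range (a + b - 2 * p + 1),
          rotCoeff c s (a + b - 2 * p) i j / (a + b - 2 * p).choose j *
          ((x - u) ^ p * linCoeff u 1 x 1 (b - p) (a - p) i) *
          ((y - v) ^ p * linCoeff v 1 y 1 (b - p) (a - p) j) := by
  rw [pow_mul_pow_eq_sum a b _ _ ((x - u) * (y - v))]
  refine Finset.sum_congr rfl fun p hp => ?_
  rw [Finset.mem_range] at hp
  have hn : a + b - 2 * p = (b - p) + (a - p) := by omega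
  have h1 := sum_linCoeff_mul_linCoeff_div_choose (u * c + s) (c - u * s) (x * c + s) (c - x * s)
    y v (b - p) (a - p) (a + b - 2 * p) hn
  have e1 : (x * c + s) * y + (c - x * s) = x * (c * y - s) + (s * y + c) := by ring
  have e2 : (u * c + s) * v + (c - u * s) = u * (c * v - s) + (s * v + c) := by ring
  -- The Plücker relation: the 2×2 determinant of pairings factors as (x - u)(y - v) times the
  -- determinant c² + s² = 1 of the rotation.
  have e3 : ((x * c + s) * v + (c - x * s)) * ((u * c + s) * y + (c - u * s)) =
      (x * (c * y - s) + (s * y + c)) * (u * (c * v - s) + (s * v + c)) - (x - u) * (y - v) := by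
    linear_combination (-(x - u) * (y - v)) * h
  rw [e1, e2, e3] at h1
  rw [← h1, cgWeight, mul_pow, Finset.sum_comm]
  simp only [Finset.mul_sum]
  refine Finset.sum_congr rfl fun j hj => ?_
  rw [Finset.mem_range] at hj
  rw [← sum_linCoeff_mul_rotCoeff c s hc hs h u x _ _ _ j hn (by omega), Finset.sum_mul,
    Finset.mul_sum, Finset.mul_sum]
  exact Finset.sum_congr rfl fun i _ => by ring

lemma rotCoeff_mul_rotCoeff (c s : ℝ) (hc : 0 ≤ c) (hs : 0 ≤ s) (h : c ^ 2 + s ^ 2 = 1)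
    (a b i₁ i₂ j₁ j₂ : ℕ) (hi₁ : i₁ ≤ a) (hi₂ : i₂ ≤ b) (hj₁ : j₁ ≤ a) (hj₂ : j₂ ≤ b) :
    a.choose i₁ * rotCoeff c s a i₁ j₁ * (b.choose i₂ * rotCoeff c s b i₂ j₂) =
      ∑ p ∈ Finset.range (min a b + 1), cgWeight a b p *
        ∑ i ∈ Finset.range (a + b - 2 * p + 1), ∑ j ∈ Finset.range (a + b - 2 * p + 1),
          rotCoeff c s (a + b - 2 * p) i j / (a + b - 2 * p).choose j *
          (if i + p = i₁ + i₂ then tripleCoeff p (b - p) (a - p) i₁ i₂ else 0) *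
          (if j + p = j₁ + j₂ then tripleCoeff p (b - p) (a - p) j₁ j₂ else 0) := by
  have key := coeff_eq_of_product_expansion (a := a + 1) (b := b + 1)
    (S := (Finset.range (min a b + 1)).sigma fun p =>
      Finset.range (a + b - 2 * p + 1) ×ˢ Finset.range (a + b - 2 * p + 1))
    (W := fun k => cgWeight a b k.1 * (rotCoeff c s (a + b - 2 * k.1) k.2.1 k.2.2 /
      (a + b - 2 * k.1).choose k.2.2))
    (T := fun k i₁ i₂ => if k.2.1 + k.1 = i₁ + i₂ then
      tripleCoeff k.1 (b - k.1) (a - k.1) i₁ i₂ else 0)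
    (U := fun k j₁ j₂ => if k.2.2 + k.1 = j₁ + j₂ then
      tripleCoeff k.1 (b - k.1) (a - k.1) j₁ j₂ else 0)
    (F := fun i j => a.choose i * rotCoeff c s a i j)
    (G := fun i j => b.choose i * rotCoeff c s b i j)
    (fun x u y v _ _ _ _ => by
      rw [sum_sum_rotCoeff, sum_sum_rotCoeff, bilinear_pow_mul_pow_eq_sum c s hc hs h,
        Finset.sum_sigma]
      refine Finset.sum_congr rfl fun p hp => ?_
      rw [Finset.mem_range] at hp
      rw [Finset.sum_product, Finset.mul_sum]
      refine Finset.sum_congr rfl fun i _ => ?_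
      rw [Finset.mul_sum]
      refine Finset.sum_congr rfl fun j _ => ?_
      rw [sub_pow_mul_linCoeff, sub_pow_mul_linCoeff, show p + (a - p) = a by omega,
        show p + (b - p) = b by omega]
      ring)
    i₁ i₂ j₁ j₂ (by omega) (by omega) (by omega) (by omega)
  rw [key, Finset.sum_sigma]
  refine Finset.sum_congr rfl fun p hp => ?_
  rw [Finset.sum_product, Finset.mul_sum]
  refine Finset.sum_congr rfl fun i _ => ?_
  rw [Finset.mul_sum]
  exact Finset.sum_congr rfl fun j _ => by ring

/-! ### Racah's formula for the 3j symbol. -/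

/-- The sums agree term by term in t. With p = l₁+l₂-l₃, q = l₂+l₃-l₁, r = l₁+l₃-l₂, the six
factorials combine into C(p,t) C(q,i₂-t) C(r,i₁-(p-t)) divided by p! q! r!. -/
lemma racah_sum_eq_tripleCoeff (l₁ l₂ l₃ i₁ i₂ : ℕ) (k₁ k₂ : ℤ) (hi₁ : (i₁ : ℤ) = l₁ + k₁)
    (hi₂ : (i₂ : ℤ) = l₂ + k₂) (h₁ : l₁ ≤ l₂ + l₃) (h₂ : l₂ ≤ l₁ + l₃) (h₃ : l₃ ≤ l₁ + l₂) :
    ∑ t ∈ (Finset.range (l₁ + l₂ - l₃ + 1)).filter (fun t : ℕ =>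
        0 ≤ (l₃ : ℤ) - l₂ + t + k₁ ∧ 0 ≤ (l₃ : ℤ) - l₁ + t - k₂ ∧
        0 ≤ (l₁ : ℤ) - t - k₁ ∧ 0 ≤ (l₂ : ℤ) - t + k₂),
      (-1 : ℝ) ^ t /
        ((t.factorial : ℝ) * (((l₃ : ℤ) - l₂ + t + k₁).toNat.factorial : ℝ) *
          (((l₃ : ℤ) - l₁ + t - k₂).toNat.factorial : ℝ) *
          ((l₁ + l₂ - l₃ - t).factorial : ℝ) *
          (((l₁ : ℤ) - t - k₁).toNat.factorial : ℝ) *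
          (((l₂ : ℤ) - t + k₂).toNat.factorial : ℝ)) =
    tripleCoeff (l₁ + l₂ - l₃) (l₂ + l₃ - l₁) (l₁ + l₃ - l₂) i₁ i₂ /
      ((l₁ + l₂ - l₃).factorial * (l₂ + l₃ - l₁).factorial * (l₁ + l₃ - l₂).factorial) := by
  rw [Finset.sum_filter, tripleCoeff, Finset.sum_div]
  refine Finset.sum_congr rfl fun t ht => ?_
  rw [Finset.mem_range] at ht
  by_cases hA : t ≤ i₂ ∧ l₁ + l₂ - l₃ - t ≤ i₁
  · rw [if_pos hA]
    -- If this fails, a binomial coefficient vanishes exactly where Racah's sum omits t.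
    by_cases hB : i₂ - t ≤ l₂ + l₃ - l₁ ∧ i₁ - (l₁ + l₂ - l₃ - t) ≤ l₁ + l₃ - l₂
    · rw [if_pos (by omega), Nat.cast_choose ℝ (by omega : t ≤ l₁ + l₂ - l₃),
        Nat.cast_choose ℝ hB.1, Nat.cast_choose ℝ hB.2]
      rw [show ((l₃ : ℤ) - l₂ + t + k₁).toNat = i₁ - (l₁ + l₂ - l₃ - t) by omega,
        show ((l₃ : ℤ) - l₁ + t - k₂).toNat = l₂ + l₃ - l₁ - (i₂ - t) by omega,
        show ((l₁ : ℤ) - t - k₁).toNat = l₁ + l₃ - l₂ - (i₁ - (l₁ + l₂ - l₃ - t)) by omega,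
        show ((l₂ : ℤ) - t + k₂).toNat = i₂ - t by omega]
      have := Nat.factorial_ne_zero (l₁ + l₂ - l₃)
      have := Nat.factorial_ne_zero (l₂ + l₃ - l₁)
      have := Nat.factorial_ne_zero (l₁ + l₃ - l₂)
      field_simp
    · rw [if_neg (by omega)]
      rcases not_and_or.mp hB with hB | hB
      · rw [Nat.choose_eq_zero_of_lt (not_le.mp hB)]
        simp
      · rw [Nat.choose_eq_zero_of_lt (not_le.mp hB)]
        simp
  · rw [if_neg hA, if_neg (by omega), zero_div]

lemma factorial_mul_factorial_eq_div_choose {n i : ℕ} (hi : i ≤ n) :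
    (i.factorial : ℝ) * (n - i).factorial = n.factorial / n.choose i := by
  rw [Nat.cast_choose ℝ hi]
  have := Nat.factorial_ne_zero n
  field_simp

/-- Here (l+k)!(l-k)! = (2l)!/C(2l,l+k). The third index is l₃ - k₃ = l₃ + k₁ + k₂, the position of
the coupled order. -/
lemma wigner3j_eq_tripleCoeff (l₁ l₂ l₃ i₁ i₂ i₃ : ℕ) (k₁ k₂ k₃ : ℤ) (hk : k₁ + k₂ + k₃ = 0)
    (hi₁ : (i₁ : ℤ) = l₁ + k₁) (hi₂ : (i₂ : ℤ) = l₂ + k₂) (hi₃ : (i₃ : ℤ) = l₃ - k₃)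
    (hb₁ : i₁ ≤ 2 * l₁) (hb₂ : i₂ ≤ 2 * l₂) (hb₃ : i₃ ≤ 2 * l₃)
    (h₁ : l₁ ≤ l₂ + l₃) (h₂ : l₂ ≤ l₁ + l₃) (h₃ : l₃ ≤ l₁ + l₂) :
    wigner3j l₁ l₂ l₃ k₁ k₂ k₃ = (-1 : ℝ) ^ ((l₁ : ℤ) - l₂ - k₃) *
      Real.sqrt (((l₁ + l₂ - l₃).factorial * (l₁ + l₃ - l₂).factorial *
        (l₂ + l₃ - l₁).factorial) / (l₁ + l₂ + l₃ + 1).factorial) *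
      (Real.sqrt ((2 * l₁).factorial * (2 * l₂).factorial * (2 * l₃).factorial) /
        (Real.sqrt ((2 * l₁).choose i₁) * Real.sqrt ((2 * l₂).choose i₂) *
          Real.sqrt ((2 * l₃).choose i₃))) *
      (tripleCoeff (l₁ + l₂ - l₃) (l₂ + l₃ - l₁) (l₁ + l₃ - l₂) i₁ i₂ /
        ((l₁ + l₂ - l₃).factorial * (l₂ + l₃ - l₁).factorial * (l₁ + l₃ - l₂).factorial)) := by
  rw [wigner3j, if_pos (by simp only [abs_le]; omega),
    racah_sum_eq_tripleCoeff l₁ l₂ l₃ i₁ i₂ k₁ k₂ hi₁ hi₂ h₁ h₂ h₃]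
  congr 2
  rw [← Real.sqrt_mul (by positivity), ← Real.sqrt_mul (by positivity),
    ← Real.sqrt_div (by positivity)]
  rw [show ((l₁ : ℤ) + k₁).toNat = i₁ by omega, show ((l₁ : ℤ) - k₁).toNat = 2 * l₁ - i₁ by omega,
    show ((l₂ : ℤ) + k₂).toNat = i₂ by omega, show ((l₂ : ℤ) - k₂).toNat = 2 * l₂ - i₂ by omega,
    show ((l₃ : ℤ) + k₃).toNat = 2 * l₃ - i₃ by omega, show ((l₃ : ℤ) - k₃).toNat = i₃ by omega]
  congr 1
  have e₁ := factorial_mul_factorial_eq_div_choose hb₁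
  have e₂ := factorial_mul_factorial_eq_div_choose hb₂
  have e₃ := factorial_mul_factorial_eq_div_choose hb₃
  rw [mul_comm] at e₃
  rw [e₁, mul_assoc _ (i₂.factorial : ℝ), e₂, mul_assoc _ ((2 * l₃ - i₃).factorial : ℝ), e₃]
  have p₁ : ((2 * l₁).choose i₁ : ℝ) ≠ 0 := by exact_mod_cast (Nat.choose_pos hb₁).ne'
  have p₂ : ((2 * l₂).choose i₂ : ℝ) ≠ 0 := by exact_mod_cast (Nat.choose_pos hb₂).ne'
  have p₃ : ((2 * l₃).choose i₃ : ℝ) ≠ 0 := by exact_mod_cast (Nat.choose_pos hb₃).ne'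
  field_simp

lemma wigner3j_eq_zero_of_abs_lt {l₁ l₂ l₃ : ℕ} {k₁ k₂ k₃ : ℤ} (h : (l₃ : ℤ) < |k₃|) :
    wigner3j l₁ l₂ l₃ k₁ k₂ k₃ = 0 := by
  rw [wigner3j, if_neg]
  intro h'
  exact absurd h'.2.2.1 (not_le.mpr h)

/-! ### Normalisation and the Clebsch-Gordan series. -/

/-- Matrix coefficients of a rotation in the orthonormal basis of binary forms of degree
`2 * l`. -/
def rotMatrix (c s : ℝ) (l : ℕ) (k n : ℤ) : ℝ :=
  Real.sqrt ((2 * l).choose (l + k).toNat) / Real.sqrt ((2 * l).choose (l + n).toNat) *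
    rotCoeff c s (2 * l) (l + k).toNat (l + n).toNat

lemma rotMatrix_eq (c s : ℝ) (l i j : ℕ) (k n : ℤ) (hi : (i : ℤ) = l + k) (hj : (j : ℤ) = l + n) :
    rotMatrix c s l k n = Real.sqrt ((2 * l).choose i) / Real.sqrt ((2 * l).choose j) *
      rotCoeff c s (2 * l) i j := by
  rw [rotMatrix, ← hi, ← hj]
  rfl

lemma neg_one_zpow_mul_self (z : ℤ) : (-1 : ℝ) ^ z * (-1) ^ z = 1 := by
  rw [← mul_zpow]
  simp

/-- The two 3j symbols carry the same triangle and (2l)! roots, whose squares, times 2l + 1 and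
after division by (p! q! r!)², give `cgWeight`. The binomial roots of the coupled degree cancel
against those in `rotMatrix`, leaving the single factor 1/C(2l,j). -/
lemma cgWeight_mul_rotCoeff (c s : ℝ) (l₁ l₂ l i₁ i₂ i j₁ j₂ j : ℕ) (k₁ k₂ n₁ n₂ : ℤ)
    (hi₁ : (i₁ : ℤ) = l₁ + k₁) (hi₂ : (i₂ : ℤ) = l₂ + k₂) (hi : (i : ℤ) = l + (k₁ + k₂))
    (hj₁ : (j₁ : ℤ) = l₁ + n₁) (hj₂ : (j₂ : ℤ) = l₂ + n₂) (hj : (j : ℤ) = l + (n₁ + n₂))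
    (hi₁b : i₁ ≤ 2 * l₁) (hi₂b : i₂ ≤ 2 * l₂) (hib : i ≤ 2 * l)
    (hj₁b : j₁ ≤ 2 * l₁) (hj₂b : j₂ ≤ 2 * l₂) (hjb : j ≤ 2 * l)
    (h₁ : l₁ ≤ l₂ + l) (h₂ : l₂ ≤ l₁ + l) (h₃ : l ≤ l₁ + l₂) :
    cgWeight (2 * l₁) (2 * l₂) (l₁ + l₂ - l) *
      (rotCoeff c s (2 * l) i j / (2 * l).choose j *
        tripleCoeff (l₁ + l₂ - l) (l₂ + l - l₁) (l₁ + l - l₂) i₁ i₂ *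
        tripleCoeff (l₁ + l₂ - l) (l₂ + l - l₁) (l₁ + l - l₂) j₁ j₂) =
    (Real.sqrt ((2 * l₁).choose i₁) * Real.sqrt ((2 * l₂).choose i₂) *
      Real.sqrt ((2 * l₁).choose j₁) * Real.sqrt ((2 * l₂).choose j₂)) *
    ((-1 : ℝ) ^ (k₁ + k₂ + n₁ + n₂) * (2 * l + 1) *
      wigner3j l₁ l₂ l k₁ k₂ (-(k₁ + k₂)) * wigner3j l₁ l₂ l n₁ n₂ (-(n₁ + n₂)) *
      rotMatrix c s l (k₁ + k₂) (n₁ + n₂)) := by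
  rw [wigner3j_eq_tripleCoeff l₁ l₂ l i₁ i₂ i k₁ k₂ _ (by ring) hi₁ hi₂ (by omega) hi₁b hi₂b hib
      h₁ h₂ h₃,
    wigner3j_eq_tripleCoeff l₁ l₂ l j₁ j₂ j n₁ n₂ _ (by ring) hj₁ hj₂ (by omega) hj₁b hj₂b hjb
      h₁ h₂ h₃, rotMatrix_eq c s l i j _ _ hi hj]
  -- The exponents sum to 2(l₁ - l₂ + k₁ + k₂ + n₁ + n₂).
  have hsign : (-1 : ℝ) ^ (k₁ + k₂ + n₁ + n₂) * (-1 : ℝ) ^ ((l₁ : ℤ) - l₂ - -(k₁ + k₂)) *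
      (-1 : ℝ) ^ ((l₁ : ℤ) - l₂ - -(n₁ + n₂)) = 1 := by
    rw [← zpow_add₀ (by norm_num), ← zpow_add₀ (by norm_num)]
    exact Even.neg_one_zpow ⟨l₁ - l₂ + k₁ + k₂ + n₁ + n₂, by ring⟩
  have hw : cgWeight (2 * l₁) (2 * l₂) (l₁ + l₂ - l) =
      (2 * l + 1) * ((2 * l₁).factorial * (2 * l₂).factorial * (2 * l).factorial) /
      ((l₁ + l₂ + l + 1).factorial * (l₁ + l₂ - l).factorial * (l₂ + l - l₁).factorial *
        (l₁ + l - l₂).factorial) := by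
    rw [cgWeight, Nat.cast_choose ℝ (by omega),
      show 2 * l₁ + 2 * l₂ - (l₁ + l₂ - l) + 1 = l₁ + l₂ + l + 1 by omega,
      show 2 * l₁ + 2 * l₂ - 2 * (l₁ + l₂ - l) = 2 * l by omega,
      show 2 * l₁ - (l₁ + l₂ - l) = l₁ + l - l₂ by omega,
      show 2 * l - (l₁ + l - l₂) = l₂ + l - l₁ by omega]
    have e : ((2 * l₁ : ℕ) : ℝ) + (2 * l₂ : ℕ) - 2 * (l₁ + l₂ - l : ℕ) + 1 = 2 * l + 1 := by
      rw [Nat.cast_sub h₃]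
      push_cast
      ring
    rw [e]
    field_simp
  rw [hw]
  have pos : ∀ {n i : ℕ}, i ≤ n → Real.sqrt (n.choose i) ≠ 0 := fun hi =>
    (Real.sqrt_pos.mpr (by exact_mod_cast Nat.choose_pos hi)).ne'
  have hq : ((2 * l).choose j : ℝ) = Real.sqrt ((2 * l).choose j) * Real.sqrt ((2 * l).choose j) :=
    (Real.mul_self_sqrt (by positivity)).symm
  have s₁ := Real.mul_self_sqrt (show (0 : ℝ) ≤ ((l₁ + l₂ - l).factorial *
    (l₁ + l - l₂).factorial * (l₂ + l - l₁).factorial) / (l₁ + l₂ + l + 1).factorial by positivity)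
  have s₂ := Real.mul_self_sqrt (show (0 : ℝ) ≤
    (2 * l₁).factorial * (2 * l₂).factorial * (2 * l).factorial by positivity)
  have a₁ := pos hi₁b
  have a₂ := pos hi₂b
  have a₃ := pos hib
  have b₁ := pos hj₁b
  have b₂ := pos hj₂b
  have b₃ := pos hjb
  generalize Real.sqrt ((2 * l₁).choose i₁) = α₁ at *
  generalize Real.sqrt ((2 * l₂).choose i₂) = α₂ at *
  generalize Real.sqrt ((2 * l).choose i) = α₃ at *
  generalize Real.sqrt ((2 * l₁).choose j₁) = β₁ at *
  generalize Real.sqrt ((2 * l₂).choose j₂) = β₂ at *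
  generalize Real.sqrt ((2 * l).choose j) = β₃ at *
  generalize Real.sqrt (((l₁ + l₂ - l).factorial * (l₁ + l - l₂).factorial *
    (l₂ + l - l₁).factorial) / (l₁ + l₂ + l + 1).factorial) = σ at *
  generalize Real.sqrt ((2 * l₁).factorial * (2 * l₂).factorial * (2 * l).factorial) = τ at *
  generalize (-1 : ℝ) ^ (k₁ + k₂ + n₁ + n₂) = ε₀ at *
  generalize (-1 : ℝ) ^ ((l₁ : ℤ) - l₂ - -(k₁ + k₂)) = ε₁ at *
  generalize (-1 : ℝ) ^ ((l₁ : ℤ) - l₂ - -(n₁ + n₂)) = ε₂ at *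
  generalize tripleCoeff (l₁ + l₂ - l) (l₂ + l - l₁) (l₁ + l - l₂) i₁ i₂ = t₁
  generalize tripleCoeff (l₁ + l₂ - l) (l₂ + l - l₁) (l₁ + l - l₂) j₁ j₂ = t₂
  rw [← s₂, hq]
  have f₁ : ((l₁ + l₂ - l).factorial : ℝ) ≠ 0 := by positivity
  have f₂ : ((l₂ + l - l₁).factorial : ℝ) ≠ 0 := by positivity
  have f₃ : ((l₁ + l - l₂).factorial : ℝ) ≠ 0 := by positivity
  have f₄ : ((l₁ + l₂ + l + 1).factorial : ℝ) ≠ 0 := by positivity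
  generalize ((l₁ + l₂ - l).factorial : ℝ) = φ₁ at *
  generalize ((l₂ + l - l₁).factorial : ℝ) = φ₂ at *
  generalize ((l₁ + l - l₂).factorial : ℝ) = φ₃ at *
  generalize ((l₁ + l₂ + l + 1).factorial : ℝ) = φ₄ at *
  generalize rotCoeff c s (2 * l) i j = ρ
  trans (2 * l + 1) * (τ * τ) * ρ * t₁ * t₂ * (ε₀ * ε₁ * ε₂) * (σ * σ) /
    ((φ₁ * φ₂ * φ₃) ^ 2 * (β₃ * β₃))
  · rw [hsign, s₁]
    field_simp
  · have e : ∀ {z : ℝ}, z ≠ 0 → z / z = 1 := div_self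
    trans (2 * l + 1) * (τ * τ) * ρ * t₁ * t₂ * (ε₀ * ε₁ * ε₂) * (σ * σ) /
      ((φ₁ * φ₂ * φ₃) ^ 2 * (β₃ * β₃)) * (α₁ / α₁) * (α₂ / α₂) * (α₃ / α₃) * (β₁ / β₁) * (β₂ / β₂)
    · rw [e a₁, e a₂, e a₃, e b₁, e b₂]
      simp only [mul_one]
    · ring

/-- Clebsch-Gordan series for the matrix coefficients of rotations. -/
lemma rotMatrix_mul_rotMatrix (c s : ℝ) (hc : 0 ≤ c) (hs : 0 ≤ s) (h : c ^ 2 + s ^ 2 = 1)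
    (l₁ l₂ : ℕ) (k₁ k₂ n₁ n₂ : ℤ) (hk₁ : |k₁| ≤ l₁) (hk₂ : |k₂| ≤ l₂) (hn₁ : |n₁| ≤ l₁)
    (hn₂ : |n₂| ≤ l₂) :
    rotMatrix c s l₁ k₁ n₁ * rotMatrix c s l₂ k₂ n₂ =
      ∑ l ∈ Finset.Icc ((l₂ : ℤ) - l₁).natAbs (l₁ + l₂),
        (-1 : ℝ) ^ (k₁ + k₂ + n₁ + n₂) * (2 * l + 1) *
          wigner3j l₁ l₂ l k₁ k₂ (-(k₁ + k₂)) * wigner3j l₁ l₂ l n₁ n₂ (-(n₁ + n₂)) *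
          rotMatrix c s l (k₁ + k₂) (n₁ + n₂) := by
  rw [abs_le] at hk₁ hk₂ hn₁ hn₂
  obtain ⟨i₁, hi₁⟩ : ∃ i : ℕ, (i : ℤ) = l₁ + k₁ := ⟨(l₁ + k₁).toNat, by omega⟩
  obtain ⟨i₂, hi₂⟩ : ∃ i : ℕ, (i : ℤ) = l₂ + k₂ := ⟨(l₂ + k₂).toNat, by omega⟩
  obtain ⟨j₁, hj₁⟩ : ∃ i : ℕ, (i : ℤ) = l₁ + n₁ := ⟨(l₁ + n₁).toNat, by omega⟩
  obtain ⟨j₂, hj₂⟩ : ∃ i : ℕ, (i : ℤ) = l₂ + n₂ := ⟨(l₂ + n₂).toNat, by omega⟩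
  have pos : ∀ {n i : ℕ}, i ≤ n → 0 < Real.sqrt (n.choose i) := fun hi =>
    Real.sqrt_pos.mpr (by exact_mod_cast Nat.choose_pos hi)
  have key := rotCoeff_mul_rotCoeff c s hc hs h (2 * l₁) (2 * l₂) i₁ i₂ j₁ j₂ (by omega) (by omega)
    (by omega) (by omega)
  have hN := mul_pos (mul_pos (mul_pos (pos (show i₁ ≤ 2 * l₁ by omega))
    (pos (show i₂ ≤ 2 * l₂ by omega))) (pos (show j₁ ≤ 2 * l₁ by omega)))
    (pos (show j₂ ≤ 2 * l₂ by omega))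
  refine mul_left_cancel₀ hN.ne' ?_
  trans (2 * l₁).choose i₁ * rotCoeff c s (2 * l₁) i₁ j₁ *
    ((2 * l₂).choose i₂ * rotCoeff c s (2 * l₂) i₂ j₂)
  · rw [rotMatrix_eq c s l₁ i₁ j₁ _ _ hi₁ hj₁, rotMatrix_eq c s l₂ i₂ j₂ _ _ hi₂ hj₂]
    have q₁ := Real.mul_self_sqrt (show (0 : ℝ) ≤ (2 * l₁).choose i₁ by positivity)
    have q₂ := Real.mul_self_sqrt (show (0 : ℝ) ≤ (2 * l₂).choose i₂ by positivity)
    have r₁ := (pos (show j₁ ≤ 2 * l₁ by omega)).ne'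
    have r₂ := (pos (show j₂ ≤ 2 * l₂ by omega)).ne'
    rw [← q₁, ← q₂]
    simp only [Real.sqrt_mul_self (Real.sqrt_nonneg _)]
    field_simp
  rw [key, Finset.mul_sum]
  -- The power p of E corresponds to degree l = l₁ + l₂ - p; the bound p ≤ 2 min(l₁, l₂) becomes l ≥
  -- |l₂ - l₁|.
  refine Finset.sum_nbij' (fun p => l₁ + l₂ - p) (fun l => l₁ + l₂ - l) ?_ ?_ ?_ ?_ ?_
  · intro p hp
    rw [Finset.mem_range] at hp
    rw [Finset.mem_Icc]
    omega
  · intro l hl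
    rw [Finset.mem_Icc] at hl
    rw [Finset.mem_range]
    omega
  · intro p hp
    rw [Finset.mem_range] at hp
    omega
  · intro l hl
    rw [Finset.mem_Icc] at hl
    omega
  · intro p hp
    rw [Finset.mem_range] at hp
    obtain ⟨l, hl⟩ : ∃ l, l = l₁ + l₂ - p := ⟨_, rfl⟩
    obtain rfl : p = l₁ + l₂ - l := by omega
    rw [← hl]
    rw [show 2 * l₁ + 2 * l₂ - 2 * (l₁ + l₂ - l) = 2 * l by omega,
      show 2 * l₂ - (l₁ + l₂ - l) = l₂ + l - l₁ by omega,
      show 2 * l₁ - (l₁ + l₂ - l) = l₁ + l - l₂ by omega]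
    -- For smaller l the 3j symbol is zero, and the selection rule would need an index outside 0, …,
    -- 2l, so both sides vanish.
    by_cases hk : |k₁ + k₂| ≤ l
    swap
    · rw [wigner3j_eq_zero_of_abs_lt (k₁ := k₁) (by rw [abs_neg]; omega),
        Finset.sum_eq_zero fun i hi => Finset.sum_eq_zero fun j _ => ?_]
      · simp
      · rw [Finset.mem_range] at hi
        rw [if_neg (by rw [abs_le] at hk; omega)]
        simp
    by_cases hn : |n₁ + n₂| ≤ l
    swap
    · rw [wigner3j_eq_zero_of_abs_lt (k₁ := n₁) (by rw [abs_neg]; omega),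
        Finset.sum_eq_zero fun i _ => Finset.sum_eq_zero fun j hj => ?_]
      · simp
      · rw [Finset.mem_range] at hj
        rw [if_neg (c := j + _ = _) (by rw [abs_le] at hn; omega)]
        simp
    rw [abs_le] at hk hn
    obtain ⟨i, hi⟩ : ∃ i : ℕ, (i : ℤ) = l + (k₁ + k₂) := ⟨(l + (k₁ + k₂)).toNat, by omega⟩
    obtain ⟨j, hj⟩ : ∃ i : ℕ, (i : ℤ) = l + (n₁ + n₂) := ⟨(l + (n₁ + n₂)).toNat, by omega⟩
    rw [← cgWeight_mul_rotCoeff c s l₁ l₂ l i₁ i₂ i j₁ j₂ j k₁ k₂ n₁ n₂ hi₁ hi₂ hi hj₁ hj₂ hj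
      (by omega) (by omega) (by omega) (by omega) (by omega) (by omega) (by omega) (by omega)
      (by omega)]
    congr 1
    rw [Finset.sum_eq_single i, Finset.sum_eq_single j, if_pos (by omega), if_pos (by omega)]
    · intro j' _ hj'
      rw [if_neg (c := j' + _ = _) (by omega)]
      simp
    · intro hj'
      rw [Finset.mem_range] at hj'
      omega
    · intro i' _ hi'
      refine Finset.sum_eq_zero fun j' _ => ?_
      rw [if_neg (c := i' + _ = _) (by omega)]
      simp
    · intro hi'
      rw [Finset.mem_range] at hi'
      omega

/-! ### Jacobi polynomials and Wigner d-functions. -/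

lemma eval_iterate_derivative_mul (p q : ℝ[X]) (n : ℕ) (x : ℝ) :
    (derivative^[n] (p * q)).eval x = ∑ k ∈ Finset.range (n + 1),
      n.choose k * ((derivative^[n - k] p).eval x * (derivative^[k] q).eval x) := by
  rw [Polynomial.iterate_derivative_mul, Polynomial.eval_finsetSum]
  simp

lemma eval_iterate_derivative_X_sub_one_pow (n k : ℕ) (x : ℝ) :
    (derivative^[k] ((X - 1) ^ n : ℝ[X])).eval x = n.descFactorial k * (x - 1) ^ (n - k) := by
  rw [← C_1, Polynomial.iterate_derivative_X_sub_pow]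
  simp

lemma eval_iterate_derivative_X_add_one_pow (n k : ℕ) (x : ℝ) :
    (derivative^[k] ((X + 1) ^ n : ℝ[X])).eval x = n.descFactorial k * (x + 1) ^ (n - k) := by
  rw [← C_1, Polynomial.iterate_derivative_X_add_pow]
  simp

lemma choose_mul_descFactorial_mul_descFactorial (n k a b : ℕ) (hk : k ≤ n) :
    n.choose k * (a.descFactorial (n - k) * b.descFactorial k) =
      n.factorial * (a.choose (n - k) * b.choose k) := by
  rw [Nat.descFactorial_eq_factorial_mul_choose, Nat.descFactorial_eq_factorial_mul_choose,
    ← Nat.choose_mul_factorial_mul_factorial hk]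
  ring

/-- Leibniz's rule for (X-1)^(α+ξ) (X+1)^(α+lam). The weight is cancelled in the polynomial ring, so
the formula also holds at x = ±1. -/
lemma eval_jacobiPoly (α ξ lam : ℕ) (x : ℝ) :
    (jacobiPoly α ξ lam).eval x = ∑ t ∈ Finset.range (α + 1),
      ((α + ξ).choose (α - t) : ℝ) * (α + lam).choose t * ((x - 1) / 2) ^ t *
        ((x + 1) / 2) ^ (α - t) := by
  set J : ℝ[X] := ∑ t ∈ Finset.range (α + 1),
      C (((α + ξ).choose (α - t) : ℝ) * (α + lam).choose t / 2 ^ α) * (X - 1) ^ t *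
        (X + 1) ^ (α - t) with hJ
  have hW : ((1 - X) ^ ξ * (1 + X) ^ lam : ℝ[X]) ≠ 0 := by
    intro h0
    have h1 := congrArg (Polynomial.eval 0) h0
    simp at h1
  have key : jacobiPoly α ξ lam = J := by
    refine mul_left_cancel₀ hW ?_
    rw [jacobiPoly_rodrigues]
    refine Polynomial.funext fun y => ?_
    have hf : ((1 - X) ^ ξ * (1 + X) ^ lam * (1 - X ^ 2) ^ α : ℝ[X]) =
        C ((-1) ^ (ξ + α)) * ((X - 1) ^ (α + ξ) * (X + 1) ^ (α + lam)) := by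
      rw [show (1 - X ^ 2 : ℝ[X]) = (1 - X) * (1 + X) by ring,
        show (1 - X : ℝ[X]) = (-1) * (X - 1) by ring, C_pow, C_neg, C_1, mul_pow,
        mul_pow, mul_pow (-1 : ℝ[X])]
      ring
    rw [hf, Polynomial.iterate_derivative_C_mul, Polynomial.eval_mul, Polynomial.eval_mul,
      eval_iterate_derivative_mul, Polynomial.eval_mul, hJ, Polynomial.eval_finsetSum,
      Finset.mul_sum, Finset.mul_sum, Finset.mul_sum]
    refine Finset.sum_congr rfl fun t ht => ?_
    rw [Finset.mem_range] at ht
    rw [eval_iterate_derivative_X_sub_one_pow, eval_iterate_derivative_X_add_one_pow]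
    have hc : (α.choose t : ℝ) * ((α + ξ).descFactorial (α - t) * (α + lam).descFactorial t) =
        α.factorial * ((α + ξ).choose (α - t) * (α + lam).choose t) := by
      exact_mod_cast choose_mul_descFactorial_mul_descFactorial α t _ _ (by omega)
    rw [show α + ξ - (α - t) = ξ + t by omega, show α + lam - t = lam + (α - t) by omega]
    simp only [Polynomial.eval_mul, Polynomial.eval_C, Polynomial.eval_pow, Polynomial.eval_sub,
      Polynomial.eval_add, Polynomial.eval_one, Polynomial.eval_X]
    have hf0 : (α.factorial : ℝ) ≠ 0 := by positivity
    have hs : (-1 : ℝ) ^ α * (-1) ^ α = 1 := by rw [← mul_pow]; simp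
    rw [show (1 - y) = (-1) * (y - 1) by ring, mul_pow]
    trans ((-1 : ℝ) ^ α * (-1) ^ α) * (-1) ^ ξ / (2 ^ α * α.factorial) *
      ((α.choose t : ℝ) * ((α + ξ).descFactorial (α - t) * (α + lam).descFactorial t)) *
      ((y - 1) ^ ξ * (y - 1) ^ t * ((y + 1) ^ lam * (y + 1) ^ (α - t)))
    · ring
    · rw [hc, hs]
      field_simp
      ring
  rw [key, hJ, Polynomial.eval_finsetSum]
  refine Finset.sum_congr rfl fun t ht => ?_
  rw [Finset.mem_range] at ht
  simp only [Polynomial.eval_mul, Polynomial.eval_C, Polynomial.eval_pow, Polynomial.eval_sub,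
      Polynomial.eval_add, Polynomial.eval_one, Polynomial.eval_X]
  rw [div_pow, div_pow, show (2 : ℝ) ^ α = 2 ^ t * 2 ^ (α - t) by
    rw [← pow_add]; congr 1; omega]
  field_simp

lemma rotCoeff_eq_sum (c s : ℝ) (n i j : ℕ) :
    rotCoeff c s n i j = ∑ e ∈ Finset.range (j + 1),
      ((n - i).choose e * s ^ e * c ^ (n - i - e)) *
        (i.choose (j - e) * c ^ (j - e) * (-s) ^ (i - (j - e))) := by
  rw [rotCoeff, linCoeff_comm, linCoeff_eq_sum]

/-- The sum in the explicit formula for the Jacobi polynomial `P_α^{(ξ,lam)}(c² - s²)`. -/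
def jacobiExpansion (c s : ℝ) (α ξ lam : ℕ) : ℝ :=
  ∑ t ∈ Finset.range (α + 1), ((α + ξ).choose (α - t) : ℝ) * (α + lam).choose t *
    (-s ^ 2) ^ t * (c ^ 2) ^ (α - t)

/-- The quotient of factorials is the γ of `wignerSmallD`. -/
lemma choose_mul_choose_eq (α ξ lam t : ℕ) (ht : t ≤ α) :
    (α.choose t : ℝ) * (α + ξ + lam).choose (ξ + t) =
      (α.factorial * (α + ξ + lam).factorial) / ((α + ξ).factorial * (α + lam).factorial) *
        ((α + ξ).choose (α - t) * (α + lam).choose t) := by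
  rw [Nat.cast_choose ℝ ht, Nat.cast_choose ℝ (by omega : ξ + t ≤ α + ξ + lam),
    Nat.cast_choose ℝ (by omega : α - t ≤ α + ξ), Nat.cast_choose ℝ (by omega : t ≤ α + lam)]
  rw [show α + ξ - (α - t) = ξ + t by omega, show α + ξ + lam - (ξ + t) = α + lam - t by omega]
  have := Nat.factorial_ne_zero (α + ξ)
  have := Nat.factorial_ne_zero (α + lam)
  field_simp

lemma sum_range_eq_of_support (f g : ℕ → ℝ) (a b n : ℕ) (hn : a + b ≤ n)
    (h₁ : ∀ e < a, f e = 0) (h₂ : ∀ e < n, a + b ≤ e → f e = 0) (h : ∀ t < b, f (a + t) = g t) :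
    ∑ e ∈ Finset.range n, f e = ∑ t ∈ Finset.range b, g t := by
  rw [← Finset.sum_subset (Finset.range_mono hn), Finset.sum_range_add,
    Finset.sum_eq_zero fun e he => h₁ e (Finset.mem_range.mp he), zero_add]
  · exact Finset.sum_congr rfl fun t ht => h t (Finset.mem_range.mp ht)
  · intro e he he'
    simp only [Finset.mem_range, not_lt] at he he'
    exact h₂ e he he'

/-- This and the next three lemmas cover the four sign patterns of k - n and k + n, each fixing (i,
j) in terms of α, ξ, lam. Vanishing binomials or the range itself leave α + 1 terms, starting at e =
ξ when k ≤ n and at e = 0 otherwise. -/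
lemma rotCoeff_eq_jacobiExpansion₁ (c s : ℝ) (α ξ lam : ℕ) :
    rotCoeff c s (2 * α + ξ + lam) (α + lam) (α + ξ + lam) =
      s ^ ξ * c ^ lam * jacobiExpansion c s α ξ lam := by
  rw [rotCoeff_eq_sum, jacobiExpansion, Finset.mul_sum,
    show 2 * α + ξ + lam - (α + lam) = α + ξ by omega]
  refine sum_range_eq_of_support _ _ ξ (α + 1) _ (by omega) (fun e he => ?_) (fun e he he' => ?_)
    (fun t ht => ?_)
  · rw [Nat.choose_eq_zero_of_lt (by omega : α + lam < α + ξ + lam - e)]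
    simp
  · rw [Nat.choose_eq_zero_of_lt (by omega : α + ξ < e)]
    simp
  · rw [show α + ξ + lam - (ξ + t) = α + lam - t by omega,
      show α + lam - (α + lam - t) = t by omega, show α + ξ - (ξ + t) = α - t by omega,
      Nat.choose_symm (by omega : t ≤ α + lam), show α + lam - t = lam + (α - t) by omega,
      ← Nat.choose_symm (by omega : ξ + t ≤ α + ξ), show α + ξ - (ξ + t) = α - t by omega,
      neg_pow s, neg_pow (s ^ 2)]
    ring

lemma rotCoeff_eq_jacobiExpansion₂ (c s : ℝ) (α ξ lam : ℕ) :
    rotCoeff c s (2 * α + ξ + lam) α (α + ξ) =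
      (α.factorial * (α + ξ + lam).factorial) / ((α + ξ).factorial * (α + lam).factorial) *
        (s ^ ξ * c ^ lam * jacobiExpansion c s α ξ lam) := by
  rw [rotCoeff_eq_sum, jacobiExpansion, Finset.mul_sum, Finset.mul_sum,
    show 2 * α + ξ + lam - α = α + ξ + lam by omega]
  refine sum_range_eq_of_support _ _ ξ (α + 1) _ (by omega) (fun e he => ?_) (fun e he he' => ?_)
    (fun t ht => ?_)
  · rw [Nat.choose_eq_zero_of_lt (by omega : α < α + ξ - e)]
    simp
  · omega
  · rw [show α + ξ - (ξ + t) = α - t by omega, show α - (α - t) = t by omega,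
      show α + ξ + lam - (ξ + t) = lam + (α - t) by omega, Nat.choose_symm (by omega : t ≤ α)]
    have h := choose_mul_choose_eq α ξ lam t (by omega)
    rw [neg_pow s, neg_pow (s ^ 2)]
    linear_combination (s ^ ξ * c ^ lam * (-1) ^ t * (s ^ 2) ^ t * (c ^ 2) ^ (α - t)) * h

lemma rotCoeff_eq_jacobiExpansion₃ (c s : ℝ) (α ξ lam : ℕ) :
    rotCoeff c s (2 * α + ξ + lam) (α + ξ + lam) (α + lam) =
      (α.factorial * (α + ξ + lam).factorial) / ((α + ξ).factorial * (α + lam).factorial) *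
        ((-s) ^ ξ * c ^ lam * jacobiExpansion c s α ξ lam) := by
  rw [rotCoeff_eq_sum, jacobiExpansion, Finset.mul_sum, Finset.mul_sum,
    show 2 * α + ξ + lam - (α + ξ + lam) = α by omega]
  refine sum_range_eq_of_support _ _ 0 (α + 1) _ (by omega) (fun e he => ?_) (fun e he he' => ?_)
    (fun t ht => ?_)
  · omega
  · rw [Nat.choose_eq_zero_of_lt (by omega : α < e)]
    simp
  · rw [zero_add, ← Nat.choose_symm (by omega : α + lam - t ≤ α + ξ + lam),
      show α + ξ + lam - (α + lam - t) = ξ + t by omega, show α + lam - t = lam + (α - t) by omega]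
    have h := choose_mul_choose_eq α ξ lam t (by omega)
    rw [neg_pow s, neg_pow s, neg_pow (s ^ 2)]
    linear_combination ((-1) ^ ξ * s ^ ξ * c ^ lam * (-1) ^ t * (s ^ 2) ^ t *
      (c ^ 2) ^ (α - t)) * h

lemma rotCoeff_eq_jacobiExpansion₄ (c s : ℝ) (α ξ lam : ℕ) :
    rotCoeff c s (2 * α + ξ + lam) (α + ξ) α =
      (-s) ^ ξ * c ^ lam * jacobiExpansion c s α ξ lam := by
  rw [rotCoeff_eq_sum, jacobiExpansion, Finset.mul_sum,
    show 2 * α + ξ + lam - (α + ξ) = α + lam by omega]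
  refine sum_range_eq_of_support _ _ 0 (α + 1) _ (by omega) (fun e he => ?_) (fun e he he' => ?_)
    (fun t ht => ?_)
  · omega
  · omega
  · rw [zero_add, show α + ξ - (α - t) = ξ + t by omega, show α + lam - t = lam + (α - t) by omega,
      neg_pow s, neg_pow s, neg_pow (s ^ 2)]
    ring

lemma sqrt_choose_div_sqrt_choose {n i j : ℕ} (hi : i ≤ n) (hj : j ≤ n) :
    Real.sqrt (n.choose i) / Real.sqrt (n.choose j) =
      Real.sqrt ((j.factorial * (n - j).factorial) / (i.factorial * (n - i).factorial)) := by
  rw [← Real.sqrt_div (by positivity)]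
  congr 1
  rw [Nat.cast_choose ℝ hi, Nat.cast_choose ℝ hj]
  have := Nat.factorial_ne_zero n
  field_simp

lemma sqrt_inv_mul_self {x : ℝ} (hx : 0 < x) : Real.sqrt x⁻¹ * x = Real.sqrt x := by
  rw [Real.sqrt_inv]
  have := (Real.sqrt_pos.mpr hx).ne'
  nth_rw 2 [← Real.mul_self_sqrt hx.le]
  field_simp

lemma eval_jacobiPoly_cos (α ξ lam : ℕ) (θ : ℝ) :
    (jacobiPoly α ξ lam).eval (Real.cos θ) =
      jacobiExpansion (Real.cos (θ / 2)) (Real.sin (θ / 2)) α ξ lam := by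
  have h : Real.cos θ = 2 * Real.cos (θ / 2) ^ 2 - 1 := by
    rw [← Real.cos_two_mul]
    congr 1
    ring
  have h2 := Real.sin_sq_add_cos_sq (θ / 2)
  rw [eval_jacobiPoly, jacobiExpansion]
  rw [show (Real.cos θ - 1) / 2 = -Real.sin (θ / 2) ^ 2 by linarith,
    show (Real.cos θ + 1) / 2 = Real.cos (θ / 2) ^ 2 by linarith]

/-- The ratio of binomial roots is √γ when the entry has no factor γ, and 1/√γ when it has one.
Either way √γ remains, and the sign ω comes from (-s)^ξ. -/
lemma wignerSmallD_eq_rotMatrix (l : ℕ) (k n : ℤ) (hk : |k| ≤ l) (hn : |n| ≤ l) (θ : ℝ) :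
    wignerSmallD l k n θ = rotMatrix (Real.cos (θ / 2)) (Real.sin (θ / 2)) l k n := by
  rw [abs_le] at hk hn
  obtain ⟨ξ, hξ⟩ : ∃ ξ, ξ = (k - n).natAbs := ⟨_, rfl⟩
  obtain ⟨lam, hlam⟩ : ∃ lam, lam = (k + n).natAbs := ⟨_, rfl⟩
  obtain ⟨α, hα⟩ : ∃ α, α = l - (ξ + lam) / 2 := ⟨_, rfl⟩
  have hl : 2 * l = 2 * α + ξ + lam := by omega
  simp only [wignerSmallD]
  rw [eval_jacobiPoly_cos, ← hξ, ← hlam, ← hα]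
  set c := Real.cos (θ / 2)
  set s := Real.sin (θ / 2)
  set J := jacobiExpansion c s α ξ lam
  have hγ : (0 : ℝ) < (α.factorial * (α + ξ + lam).factorial) /
      ((α + ξ).factorial * (α + lam).factorial) := by positivity
  have hω : ¬ k ≤ n → (-1 : ℝ) ^ (n - k) * s ^ ξ = (-s) ^ ξ := fun h => by
    rw [show n - k = -(ξ : ℤ) by omega, zpow_neg, zpow_natCast, neg_pow s, ← inv_pow]
    norm_num
  by_cases h₁ : k ≤ n <;> by_cases h₂ : 0 ≤ k + n
  · rw [rotMatrix_eq c s l (α + lam) (α + ξ + lam) k n (by omega) (by omega), hl,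
      rotCoeff_eq_jacobiExpansion₁, sqrt_choose_div_sqrt_choose (by omega) (by omega), if_pos h₁,
      show 2 * α + ξ + lam - (α + ξ + lam) = α by omega,
      show 2 * α + ξ + lam - (α + lam) = α + ξ by omega,
      mul_comm ((α + ξ + lam).factorial : ℝ), mul_comm ((α + lam).factorial : ℝ)]
    ring
  · rw [rotMatrix_eq c s l α (α + ξ) k n (by omega) (by omega), hl,
      rotCoeff_eq_jacobiExpansion₂, sqrt_choose_div_sqrt_choose (by omega) (by omega), if_pos h₁,
      show 2 * α + ξ + lam - (α + ξ) = α + lam by omega,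
      show 2 * α + ξ + lam - α = α + ξ + lam by omega,
      ← inv_div ((α.factorial : ℝ) * _), ← mul_assoc, sqrt_inv_mul_self hγ]
    ring
  · rw [rotMatrix_eq c s l (α + ξ + lam) (α + lam) k n (by omega) (by omega), hl,
      rotCoeff_eq_jacobiExpansion₃, sqrt_choose_div_sqrt_choose (by omega) (by omega), if_neg h₁,
      show 2 * α + ξ + lam - (α + ξ + lam) = α by omega,
      show 2 * α + ξ + lam - (α + lam) = α + ξ by omega,
      mul_comm ((α + ξ + lam).factorial : ℝ), mul_comm ((α + lam).factorial : ℝ),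
      ← inv_div ((α.factorial : ℝ) * _), ← mul_assoc, sqrt_inv_mul_self hγ, ← hω h₁]
    ring
  · rw [rotMatrix_eq c s l (α + ξ) α k n (by omega) (by omega), hl,
      rotCoeff_eq_jacobiExpansion₄, sqrt_choose_div_sqrt_choose (by omega) (by omega), if_neg h₁,
      show 2 * α + ξ + lam - (α + ξ) = α + lam by omega,
      show 2 * α + ξ + lam - α = α + ξ + lam by omega, ← hω h₁]
    ring

/-- Negating both orders preserves ξ, lam, α and γ; only ω changes. -/
lemma wignerSmallD_neg_neg (l : ℕ) (k n : ℤ) (θ : ℝ) :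
    wignerSmallD l (-k) (-n) θ = (-1) ^ (k - n) * wignerSmallD l k n θ := by
  simp only [wignerSmallD]
  rw [show (-k - -n).natAbs = (k - n).natAbs by omega, show (-k + -n).natAbs = (k + n).natAbs by omega]
  have e : (if -k ≤ -n then (1 : ℝ) else (-1) ^ (-n - -k)) =
      (-1) ^ (k - n) * if k ≤ n then (1 : ℝ) else (-1) ^ (n - k) := by
    rcases lt_trichotomy k n with h | h | h
    · rw [if_neg (by omega), if_pos h.le, mul_one]
      congr 1
      ring
    · subst h
      simp
    · rw [if_pos (by omega), if_neg (by omega), ← zpow_add₀ (by norm_num)]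
      simp
  rw [e]
  ring

/-! ### Associated Legendre functions and spherical harmonics. -/

lemma eval_iterate_derivative_sq_sub_one_pow (l m : ℕ) (x : ℝ) :
    (derivative^[m] ((X ^ 2 - 1) ^ l : ℝ[X])).eval x = m.factorial *
      ∑ j ∈ Finset.range (m + 1), l.choose (m - j) * l.choose j *
        ((x - 1) ^ (l - (m - j)) * (x + 1) ^ (l - j)) := by
  rw [show (X ^ 2 - 1 : ℝ[X]) = (X - 1) * (X + 1) by ring, mul_pow, eval_iterate_derivative_mul,
    Finset.mul_sum]
  refine Finset.sum_congr rfl fun j hj => ?_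
  rw [Finset.mem_range] at hj
  rw [eval_iterate_derivative_X_sub_one_pow, eval_iterate_derivative_X_add_one_pow]
  have hc : (m.choose j : ℝ) * (l.descFactorial (m - j) * l.descFactorial j) =
      m.factorial * (l.choose (m - j) * l.choose j) := by
    exact_mod_cast choose_mul_descFactorial_mul_descFactorial m j l l (by omega)
  linear_combination ((x - 1) ^ (l - (m - j)) * (x + 1) ^ (l - j)) * hc

lemma pow_mul_eval_iterate_derivative (c s : ℝ) (l k : ℕ) :
    (2 * s * c) ^ k * ∑ j ∈ Finset.range (l + k + 1), (l.choose (l + k - j) : ℝ) * l.choose j *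
        ((-(2 * s ^ 2)) ^ (l - (l + k - j)) * (2 * c ^ 2) ^ (l - j)) =
      2 ^ l * rotCoeff c s (2 * l) l (l + k) := by
  rw [rotCoeff_eq_sum, show 2 * l - l = l by omega, Finset.mul_sum, Finset.mul_sum]
  refine Finset.sum_congr rfl fun j hj => ?_
  by_cases h₁ : j ≤ l
  swap
  · rw [Nat.choose_eq_zero_of_lt (not_le.mp h₁)]
    simp
  by_cases h₂ : l + k - j ≤ l
  swap
  · rw [Nat.choose_eq_zero_of_lt (not_le.mp h₂)]
    simp
  obtain ⟨a, ha⟩ : ∃ a, j = k + a := ⟨j - k, by omega⟩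
  obtain ⟨b, hb⟩ : ∃ b, l = j + b := ⟨l - j, by omega⟩
  subst ha
  rw [show l + k - (k + a) = l - a by omega, show l - (l - a) = a by omega,
    show l - (k + a) = b by omega, show l - a = k + b by omega, neg_pow, neg_pow s]
  subst hb
  ring

/-- Serves order -k: the derivative of order l - k contains (2sc)^k explicitly, which cancels the
singular factor (1 - x²)^(-k/2). -/
lemma eval_iterate_derivative_eq_pow_mul (c s : ℝ) (l k : ℕ) (hk : k ≤ l) :
    ∑ j ∈ Finset.range (l - k + 1), (l.choose (l - k - j) : ℝ) * l.choose j *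
        ((-(2 * s ^ 2)) ^ (l - (l - k - j)) * (2 * c ^ 2) ^ (l - j)) =
      (2 * s * c) ^ k * (2 ^ l * rotCoeff c s (2 * l) l (l - k)) := by
  rw [rotCoeff_eq_sum, show 2 * l - l = l by omega, Finset.mul_sum, Finset.mul_sum]
  refine Finset.sum_congr rfl fun j hj => ?_
  rw [Finset.mem_range] at hj
  obtain ⟨b, hb⟩ : ∃ b, l = k + j + b := ⟨l - k - j, by omega⟩
  rw [show l - k - j = b by omega, show l - b = k + j by omega, show l - j = k + b by omega,
    neg_pow, neg_pow s]
  subst hb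
  ring

lemma rotCoeff_eq_zero_of_mul_eq_zero (c s : ℝ) (h : s = 0 ∨ c = 0) (l k : ℕ) (hk : k ≤ l)
    (hk0 : 0 < k) : rotCoeff c s (2 * l) l (l - k) = 0 := by
  rw [rotCoeff_eq_sum]
  refine Finset.sum_eq_zero fun j hj => ?_
  rw [Finset.mem_range] at hj
  rcases h with rfl | rfl
  · rw [neg_zero, zero_pow (by omega : l - (l - k - j) ≠ 0)]
    simp
  · rw [zero_pow (by omega : 2 * l - l - j ≠ 0)]
    simp

lemma assocLegendre_cos (l : ℕ) (k : ℤ) (hk : |k| ≤ l) (θ : ℝ) (hθ : θ ∈ Set.Icc 0 Real.pi) :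
    assocLegendre l k (Real.cos θ) = (-1) ^ k * ((l + k).toNat.factorial / l.factorial) *
      rotCoeff (Real.cos (θ / 2)) (Real.sin (θ / 2)) (2 * l) l (l + k).toNat := by
  rw [abs_le] at hk
  have hs : 0 ≤ Real.sin (θ / 2) := Real.sin_nonneg_of_nonneg_of_le_pi (by linarith [hθ.1])
    (by linarith [hθ.2, Real.pi_pos])
  have hc : 0 ≤ Real.cos (θ / 2) := Real.cos_nonneg_of_neg_pi_div_two_le_of_le
    (by linarith [hθ.1, Real.pi_pos]) (by linarith [hθ.2])
  have hcos : Real.cos θ = 2 * Real.cos (θ / 2) ^ 2 - 1 := by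
    rw [← Real.cos_two_mul]
    congr 1
    ring
  have hsq := Real.sin_sq_add_cos_sq (θ / 2)
  set c := Real.cos (θ / 2)
  set s := Real.sin (θ / 2)
  have e₁ : Real.cos θ - 1 = -(2 * s ^ 2) := by linarith
  have e₂ : Real.cos θ + 1 = 2 * c ^ 2 := by linarith
  have e₃ : 1 - Real.cos θ ^ 2 = (2 * s * c) ^ 2 := by
    linear_combination (-(Real.cos θ + 1)) * e₁ + 2 * s ^ 2 * e₂
  have hsc : 0 ≤ 2 * s * c := by positivity
  -- On [0, π] the base is the square of 2sc = sin θ ≥ 0, so the half-integral power becomes an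
  -- integral one.
  have e₄ : (1 - Real.cos θ ^ 2) ^ ((k : ℝ) / 2) = (2 * s * c) ^ k := by
    rw [e₃, ← Real.rpow_natCast, ← Real.rpow_mul hsc, ← Real.rpow_intCast]
    congr 1
    push_cast
    ring
  rw [assocLegendre, e₄, eval_iterate_derivative_sq_sub_one_pow, e₁, e₂, add_comm k]
  have hl0 : (l.factorial : ℝ) ≠ 0 := by positivity
  rcases le_total 0 k with h | h
  · obtain ⟨κ, rfl⟩ := Int.eq_ofNat_of_zero_le h
    have key := pow_mul_eval_iterate_derivative c s l κ
    rw [show ((l : ℤ) + κ).toNat = l + κ by omega, zpow_natCast (2 * s * c)]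
    trans (-1) ^ (κ : ℤ) / (2 ^ l * l.factorial) * (l + κ).factorial *
      (2 ^ l * rotCoeff c s (2 * l) l (l + κ))
    · rw [← key]
      ring
    · field_simp
  · obtain ⟨κ, rfl⟩ : ∃ κ : ℕ, k = -(κ : ℤ) := ⟨(-k).toNat, by omega⟩
    have key := eval_iterate_derivative_eq_pow_mul c s l κ (by omega)
    rw [show ((l : ℤ) + -(κ : ℤ)).toNat = l - κ by omega, key]
    rcases eq_or_ne κ 0 with h0 | h0
    · subst h0
      simp
      field_simp
    -- At the poles (2sc)^κ cannot be cancelled, but there the matrix entry is zero, in accordance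
    -- with the limit 0.
    rcases eq_or_ne (2 * s * c) 0 with hz | hz
    · rw [rotCoeff_eq_zero_of_mul_eq_zero c s (by simpa using hz) l κ (by omega) (by omega)]
      simp
    · rw [zpow_neg (2 * s * c), zpow_natCast]
      field_simp

/-- Both sides reduce to the middle row i = l of the rotation matrix, that is, to the coefficients
of (cy - s)^l (sy + c)^l. -/
lemma sphericalHarmonic_eq_wignerSmallD (l : ℕ) (k : ℤ) (hk : |k| ≤ l) (θ φ : ℝ)
    (hθ : θ ∈ Set.Icc 0 Real.pi) :
    sphericalHarmonic l k θ φ = ((Real.sqrt ((2 * l + 1) / (4 * Real.pi)) * (-1) ^ k *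
      wignerSmallD l 0 k θ : ℝ) : ℂ) * Complex.exp (Complex.I * k * φ) := by
  rw [sphericalHarmonic, assocLegendre_cos l k hk θ hθ,
    wignerSmallD_eq_rotMatrix l 0 k (by simp) hk]
  rw [abs_le] at hk
  congr 2
  obtain ⟨j, hj⟩ : ∃ j : ℕ, (j : ℤ) = l + k := ⟨(l + k).toNat, by omega⟩
  rw [rotMatrix_eq _ _ l l j 0 k (by ring) hj, ← hj, Int.toNat_natCast,
    show ((l : ℤ) - k).toNat = 2 * l - j by omega,
    sqrt_choose_div_sqrt_choose (by omega) (by omega), show 2 * l - l = l by omega,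
    Real.sqrt_mul (by positivity)]
  have h : Real.sqrt (((2 * l - j).factorial : ℝ) / j.factorial) * (j.factorial / l.factorial) =
      Real.sqrt ((j.factorial * (2 * l - j).factorial) / (l.factorial * l.factorial)) := by
    rw [← Real.sqrt_sq (show (0 : ℝ) ≤ j.factorial / l.factorial by positivity),
      ← Real.sqrt_mul (by positivity)]
    congr 1
    have := Nat.factorial_ne_zero j
    field_simp
  rw [← h]
  ring

/-! ### Product expansions of d-functions, D-functions and spherical harmonics. -/

/-- Clebsch-Gordan series for Wigner d-functions. -/
lemma wignerSmallD_mul_wignerSmallD (l₁ l₂ : ℕ) (k₁ k₂ n₁ n₂ : ℤ) (hk₁ : |k₁| ≤ l₁)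
    (hk₂ : |k₂| ≤ l₂) (hn₁ : |n₁| ≤ l₁) (hn₂ : |n₂| ≤ l₂) (θ : ℝ) (hθ : θ ∈ Set.Icc 0 Real.pi) :
    wignerSmallD l₁ k₁ n₁ θ * wignerSmallD l₂ k₂ n₂ θ =
      (-1 : ℝ) ^ (k₂ + n₂) * ∑ l ∈ Finset.Icc ((l₂ : ℤ) - l₁).natAbs (l₁ + l₂),
        (2 * l + 1) * wigner3j l₁ l₂ l (-n₁) n₂ (-(n₂ - n₁)) *
          wigner3j l₁ l₂ l (-k₁) k₂ (-(k₂ - k₁)) * wignerSmallD l (k₂ - k₁) (n₂ - n₁) θ := by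
  have hs : 0 ≤ Real.sin (θ / 2) := Real.sin_nonneg_of_nonneg_of_le_pi (by linarith [hθ.1])
    (by linarith [hθ.2, Real.pi_pos])
  have hc : 0 ≤ Real.cos (θ / 2) := Real.cos_nonneg_of_neg_pi_div_two_le_of_le
    (by linarith [hθ.1, Real.pi_pos]) (by linarith [hθ.2])
  have key := rotMatrix_mul_rotMatrix _ _ hc hs (Real.cos_sq_add_sin_sq (θ / 2)) l₁ l₂ (-k₁) k₂
    (-n₁) n₂ (by rwa [abs_neg]) hk₂ (by rwa [abs_neg]) hn₂
  rw [← wignerSmallD_eq_rotMatrix l₁ _ _ (by rwa [abs_neg]) (by rwa [abs_neg]),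
    ← wignerSmallD_eq_rotMatrix l₂ _ _ hk₂ hn₂, wignerSmallD_neg_neg] at key
  have hsign := neg_one_zpow_mul_self (k₁ - n₁)
  -- Inserting the square of this sign replaces the orders (k₁, n₁) by (-k₁, -n₁), to which the
  -- series is applied.
  trans (-1) ^ (k₁ - n₁) *
    ((-1) ^ (k₁ - n₁) * wignerSmallD l₁ k₁ n₁ θ * wignerSmallD l₂ k₂ n₂ θ)
  · linear_combination (-(wignerSmallD l₁ k₁ n₁ θ * wignerSmallD l₂ k₂ n₂ θ)) * hsign
  rw [key, Finset.mul_sum, Finset.mul_sum]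
  refine Finset.sum_congr rfl fun l _ => ?_
  rw [show -k₁ + k₂ = k₂ - k₁ by ring, show -n₁ + n₂ = n₂ - n₁ by ring]
  by_cases hk : |k₂ - k₁| ≤ l
  swap
  · rw [wigner3j_eq_zero_of_abs_lt (k₁ := -k₁) (by rw [abs_neg]; omega)]
    simp
  by_cases hn : |n₂ - n₁| ≤ l
  swap
  · rw [wigner3j_eq_zero_of_abs_lt (k₁ := -n₁) (by rw [abs_neg]; omega)]
    simp
  rw [wignerSmallD_eq_rotMatrix l _ _ hk hn]
  have e : (-1 : ℝ) ^ (k₁ - n₁) * (-1) ^ (k₂ - k₁ + -n₁ + n₂) = (-1) ^ (k₂ + n₂) := by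
    rw [← zpow_add₀ (by norm_num), show k₁ - n₁ + (k₂ - k₁ + -n₁ + n₂) = k₂ + n₂ + 2 * -n₁ by ring,
      zpow_add₀ (by norm_num), zpow_mul]
    simp
  rw [← e]
  ring

/-- Splits the factor D = 2l + 1 of the series: one square root normalises the function of degree l,
the other joins the coupling constant. -/
lemma sqrt_div_mul_sqrt_div_mul (A B D d : ℝ) (hA : 0 ≤ A) (hB : 0 ≤ B) (hD : 0 ≤ D)
    (hd : 0 < d) :
    Real.sqrt (A / d) * Real.sqrt (B / d) * D = Real.sqrt (A * B * D / d) * Real.sqrt (D / d) := by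
  rw [← Real.sqrt_mul (by positivity), ← Real.sqrt_mul (by positivity)]
  conv_lhs => rw [← Real.sqrt_sq hD, ← Real.sqrt_mul (by positivity)]
  congr 1
  field_simp

lemma conj_wignerD_mul_wignerD (l₁ l₂ : ℕ) (k₁ k₂ n₁ n₂ : ℤ) (hk₁ : |k₁| ≤ l₁)
    (hk₂ : |k₂| ≤ l₂) (hn₁ : |n₁| ≤ l₁) (hn₂ : |n₂| ≤ l₂) (θ φ χ : ℝ)
    (hθ : θ ∈ Set.Icc 0 Real.pi) :
    (starRingEnd ℂ) (wignerD l₁ k₁ n₁ θ φ χ) * wignerD l₂ k₂ n₂ θ φ χ =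
      (-1 : ℂ) ^ (k₂ + n₂) * ∑ l ∈ Finset.Icc ((l₂ : ℤ) - l₁).natAbs (l₁ + l₂),
        (Real.sqrt ((2 * l₁ + 1) * (2 * l₂ + 1) * (2 * l + 1) / (8 * Real.pi ^ 2)) : ℂ) *
        (wigner3j l₁ l₂ l (-n₁) n₂ (-(n₂ - n₁)) : ℂ) *
        (wigner3j l₁ l₂ l (-k₁) k₂ (-(k₂ - k₁)) : ℂ) *
        wignerD l (k₂ - k₁) (n₂ - n₁) θ φ χ := by
  have key := congrArg (fun z : ℝ => (z : ℂ))
    (wignerSmallD_mul_wignerSmallD l₁ l₂ k₁ k₂ n₁ n₂ hk₁ hk₂ hn₁ hn₂ θ hθ)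
  simp only [Complex.ofReal_mul, Complex.ofReal_sum, Complex.ofReal_zpow, Complex.ofReal_neg,
    Complex.ofReal_one] at key
  simp only [wignerD, map_mul, Complex.conj_ofReal, ← Complex.exp_conj, map_neg, Complex.conj_I,
    map_intCast]
  have he : Complex.exp (-(-Complex.I * k₁ * φ)) * Complex.exp (-(-Complex.I * n₁ * χ)) *
      (Complex.exp (-(Complex.I * k₂ * φ)) * Complex.exp (-(Complex.I * n₂ * χ))) =
      Complex.exp (-(Complex.I * (k₂ - k₁ : ℤ) * φ)) *
        Complex.exp (-(Complex.I * (n₂ - n₁ : ℤ) * χ)) := by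
    rw [← Complex.exp_add, ← Complex.exp_add, ← Complex.exp_add, ← Complex.exp_add]
    congr 1
    push_cast
    ring
  trans (Real.sqrt ((2 * l₁ + 1) / (8 * Real.pi ^ 2)) : ℂ) *
      (Real.sqrt ((2 * l₂ + 1) / (8 * Real.pi ^ 2)) : ℂ) *
      ((wignerSmallD l₁ k₁ n₁ θ : ℂ) * wignerSmallD l₂ k₂ n₂ θ) *
      (Complex.exp (-(-Complex.I * k₁ * φ)) * Complex.exp (-(-Complex.I * n₁ * χ)) *
      (Complex.exp (-(Complex.I * k₂ * φ)) * Complex.exp (-(Complex.I * n₂ * χ))))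
  · ring
  rw [he, key]
  simp only [Finset.mul_sum, Finset.sum_mul]
  refine Finset.sum_congr rfl fun l _ => ?_
  have hN := congrArg (fun z : ℝ => (z : ℂ)) (sqrt_div_mul_sqrt_div_mul (2 * l₁ + 1) (2 * l₂ + 1)
    (2 * l + 1) (8 * Real.pi ^ 2) (by positivity) (by positivity) (by positivity) (by positivity))
  simp only [Complex.ofReal_mul] at hN
  linear_combination ((-1) ^ (k₂ + n₂) * wigner3j l₁ l₂ l (-n₁) n₂ (-(n₂ - n₁)) *
    wigner3j l₁ l₂ l (-k₁) k₂ (-(k₂ - k₁)) * wignerSmallD l (k₂ - k₁) (n₂ - n₁) θ *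
    (Complex.exp (-(Complex.I * (k₂ - k₁ : ℤ) * φ)) *
        Complex.exp (-(Complex.I * (n₂ - n₁ : ℤ) * χ))) : ℂ) * hN

lemma conj_sphericalHarmonic (l : ℕ) (k : ℤ) (hk : |k| ≤ l) (θ φ : ℝ)
    (hθ : θ ∈ Set.Icc 0 Real.pi) :
    (starRingEnd ℂ) (sphericalHarmonic l k θ φ) = (-1) ^ k * sphericalHarmonic l (-k) θ φ := by
  have h := wignerSmallD_neg_neg l 0 k θ
  rw [neg_zero, zero_sub] at h
  rw [sphericalHarmonic_eq_wignerSmallD l k hk θ φ hθ,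
    sphericalHarmonic_eq_wignerSmallD l (-k) (by rwa [abs_neg]) θ φ hθ, h]
  simp only [map_mul, Complex.conj_ofReal, ← Complex.exp_conj, Complex.conj_I, map_intCast]
  have e : (-1 : ℂ) ^ k * (-1 : ℂ) ^ k = 1 := by
    rw [← mul_zpow]
    simp
  have e' : (-1 : ℂ) ^ (-k) = (-1 : ℂ) ^ k := by
    rw [zpow_neg, ← inv_zpow]
    norm_num
  push_cast
  rw [e', show -Complex.I * k * φ = Complex.I * -k * φ by ring]
  linear_combination (-(Real.sqrt ((2 * l + 1) / (4 * Real.pi)) : ℂ) * (-1) ^ k *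
    wignerSmallD l 0 k θ * Complex.exp (Complex.I * -k * φ)) * e

lemma conj_sphericalHarmonic_mul_sphericalHarmonic (l₁ l₂ : ℕ) (k₁ k₂ : ℤ) (hk₁ : |k₁| ≤ l₁)
    (hk₂ : |k₂| ≤ l₂) (θ φ : ℝ) (hθ : θ ∈ Set.Icc 0 Real.pi) :
    (starRingEnd ℂ) (sphericalHarmonic l₁ k₁ θ φ) * sphericalHarmonic l₂ k₂ θ φ =
      (-1 : ℂ) ^ k₂ * ∑ l ∈ Finset.Icc ((l₁ : ℤ) - l₂).natAbs (l₁ + l₂),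
        (Real.sqrt ((2 * l₁ + 1) * (2 * l₂ + 1) * (2 * l + 1) / (4 * Real.pi)) : ℂ) *
        (wigner3j l₁ l₂ l 0 0 0 : ℂ) * (wigner3j l₁ l₂ l (-k₁) k₂ (-(k₂ - k₁)) : ℂ) *
        sphericalHarmonic l (k₂ - k₁) θ φ := by
  -- Zero row orders give the 3j symbol with vanishing lower row. The signs (-1)^k₁ (-1)^k₂ of the
  -- two factors are absorbed by the harmonic of order k₂ - k₁, leaving the (-1)^k₂ of the series.
  have key := congrArg (fun z : ℝ => (z : ℂ))
    (wignerSmallD_mul_wignerSmallD l₁ l₂ 0 0 k₁ k₂ (by simp) (by simp) hk₁ hk₂ θ hθ)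
  simp only [Complex.ofReal_mul, Complex.ofReal_sum, Complex.ofReal_zpow, Complex.ofReal_neg,
    Complex.ofReal_one, sub_zero, neg_zero, zero_add] at key
  rw [sphericalHarmonic_eq_wignerSmallD l₁ k₁ hk₁ θ φ hθ,
    sphericalHarmonic_eq_wignerSmallD l₂ k₂ hk₂ θ φ hθ]
  simp only [map_mul, Complex.conj_ofReal, ← Complex.exp_conj, Complex.conj_I, map_intCast,
    Complex.ofReal_mul, Complex.ofReal_zpow, Complex.ofReal_neg, Complex.ofReal_one,
    map_zpow₀, map_neg, map_one]
  have he : Complex.exp (-Complex.I * k₁ * φ) * Complex.exp (Complex.I * k₂ * φ) =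
      Complex.exp (Complex.I * (k₂ - k₁ : ℤ) * φ) := by
    rw [← Complex.exp_add]
    congr 1
    push_cast
    ring
  have hsign : (-1 : ℂ) ^ k₁ * (-1 : ℂ) ^ k₂ = (-1) ^ (k₂ - k₁) := by
    rw [zpow_sub₀ (by norm_num), div_eq_mul_inv, ← inv_zpow, mul_comm]
    norm_num
  trans (Real.sqrt ((2 * l₁ + 1) / (4 * Real.pi)) : ℂ) *
      (Real.sqrt ((2 * l₂ + 1) / (4 * Real.pi)) : ℂ) * ((-1) ^ k₁ * (-1) ^ k₂) *
      ((wignerSmallD l₁ 0 k₁ θ : ℂ) * wignerSmallD l₂ 0 k₂ θ) *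
      (Complex.exp (-Complex.I * k₁ * φ) * Complex.exp (Complex.I * k₂ * φ))
  · ring
  rw [he, key, hsign, show ((l₁ : ℤ) - l₂).natAbs = ((l₂ : ℤ) - l₁).natAbs by omega]
  simp only [Finset.mul_sum, Finset.sum_mul]
  refine Finset.sum_congr rfl fun l _ => ?_
  by_cases hk : |k₂ - k₁| ≤ l
  swap
  · rw [wigner3j_eq_zero_of_abs_lt (k₁ := -k₁) (by rw [abs_neg]; omega)]
    simp
  rw [sphericalHarmonic_eq_wignerSmallD l _ hk θ φ hθ]
  have hN := congrArg (fun z : ℝ => (z : ℂ)) (sqrt_div_mul_sqrt_div_mul (2 * l₁ + 1) (2 * l₂ + 1)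
    (2 * l + 1) (4 * Real.pi) (by positivity) (by positivity) (by positivity) (by positivity))
  simp only [Complex.ofReal_mul, Complex.ofReal_zpow, Complex.ofReal_neg, Complex.ofReal_one]
    at hN ⊢
  linear_combination ((-1) ^ k₂ * (-1) ^ (k₂ - k₁) * wigner3j l₁ l₂ l (-k₁) k₂ (-(k₂ - k₁)) *
    wigner3j l₁ l₂ l 0 0 0 * wignerSmallD l 0 (k₂ - k₁) θ *
    Complex.exp (Complex.I * (k₂ - k₁ : ℤ) * φ) : ℂ) * hN

lemma sum_mul_sum_comm {ι κ : Type*} (S : Finset ι) (R : Finset κ) (ε : ℂ) (w : κ → ℂ)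
    (F : κ → ι → ℂ) :
    ∑ p ∈ S, ε * ∑ l ∈ R, w l * F l p = ε * ∑ l ∈ R, w l * ∑ p ∈ S, F l p := by
  rw [← Finset.mul_sum, Finset.sum_comm]
  simp only [Finset.mul_sum]

end

theorem proposition1 (m : ℕ) (θ φ : Fin m → ℝ) (hθ : ∀ p, θ p ∈ Set.Icc 0 Real.pi)
    (l₁ l₂ : ℕ) (k₁ k₂ : ℤ) (hk₁ : |k₁| ≤ l₁) (hk₂ : |k₂| ≤ l₂) :
    (∀ (χ : Fin m → ℝ) (n₁ n₂ : ℤ), |n₁| ≤ l₁ → |n₂| ≤ l₂ →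
      ∑ p, (starRingEnd ℂ) (wignerD l₁ k₁ n₁ (θ p) (φ p) (χ p)) *
          wignerD l₂ k₂ n₂ (θ p) (φ p) (χ p) =
        (-1 : ℂ) ^ (k₂ + n₂) *
          ∑ l ∈ Finset.Icc ((l₂ : ℤ) - l₁).natAbs (l₁ + l₂),
            (Real.sqrt ((2 * l₁ + 1) * (2 * l₂ + 1) * (2 * l + 1) / (8 * Real.pi ^ 2)) : ℂ) *
            (wigner3j l₁ l₂ l (-n₁) n₂ (-(n₂ - n₁)) : ℂ) *
            (wigner3j l₁ l₂ l (-k₁) k₂ (-(k₂ - k₁)) : ℂ) *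
            ∑ p, wignerD l (k₂ - k₁) (n₂ - n₁) (θ p) (φ p) (χ p)) ∧
    (∑ p, (starRingEnd ℂ) (sphericalHarmonic l₁ k₁ (θ p) (φ p)) *
          sphericalHarmonic l₂ k₂ (θ p) (φ p) =
        ∑ p, (-1 : ℂ) ^ k₁ * sphericalHarmonic l₁ (-k₁) (θ p) (φ p) *
          sphericalHarmonic l₂ k₂ (θ p) (φ p)) ∧
    (∑ p, (starRingEnd ℂ) (sphericalHarmonic l₁ k₁ (θ p) (φ p)) *
          sphericalHarmonic l₂ k₂ (θ p) (φ p) =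
        (-1 : ℂ) ^ k₂ *
          ∑ l ∈ Finset.Icc ((l₁ : ℤ) - l₂).natAbs (l₁ + l₂),
            (Real.sqrt ((2 * l₁ + 1) * (2 * l₂ + 1) * (2 * l + 1) / (4 * Real.pi)) : ℂ) *
            (wigner3j l₁ l₂ l 0 0 0 : ℂ) *
            (wigner3j l₁ l₂ l (-k₁) k₂ (-(k₂ - k₁)) : ℂ) *
            ∑ p, sphericalHarmonic l (k₂ - k₁) (θ p) (φ p)) := by
  refine ⟨fun χ n₁ n₂ hn₁ hn₂ => ?_, ?_, ?_⟩
  · rw [← sum_mul_sum_comm]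
    exact Finset.sum_congr rfl fun p _ =>
      conj_wignerD_mul_wignerD l₁ l₂ k₁ k₂ n₁ n₂ hk₁ hk₂ hn₁ hn₂ _ _ _ (hθ p)
  · exact Finset.sum_congr rfl fun p _ => by
      rw [conj_sphericalHarmonic l₁ k₁ hk₁ _ _ (hθ p)]
  · rw [← sum_mul_sum_comm]
    exact Finset.sum_congr rfl fun p _ =>
      conj_sphericalHarmonic_mul_sphericalHarmonic l₁ l₂ k₁ k₂ hk₁ hk₂ _ _ (hθ p)
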